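/- Let $\mathcal A$ be a compact set of real $d\times d$ matrices and let $m:\mathcal A\to(0,+\infty)$. For a function $M:\mathcal A\to[0,+\infty]$, the linear switching system $\{\mathcal A,m,M\}$ is $\dot x(t)=A(t)x(t)$, $t\ge 0$, where $A(\cdot)$ is any piecewise constant function $[0,+\infty)\to\mathcal A$ (switching law) with finitely or infinitely many switching points (its points of discontinuity), finitely many on every bounded interval, such that every switching interval (maximal interval of constancy) with value $A$ has length at least $m(A)$ and at most $M(A)$; an infinite switching interval is allowed only if $M(A)=+\infty$. The system is called stable if every trajectory, for every admissible switching law and every initial point, tends to $0$ as $t\to+\infty$. We write $\{\mathcal A,m\}$ for $\{\mathcal A,m,+\infty\}$. For a Hurwitz matrix $A$ (all eigenvalues have negative real parts) and $x_0\in\mathbb R^d$, let $x(t)=e^{tA}x_0$, and let $G$ be the convex hull of $\{\pm x(t)\mid t\ge 0\}$. A number $T>0$ is a cut tail point of $A$ if for every $x_0\in\mathbb R^d$ and every $t\ge T$ the point $x(t)$ belongs to the relative interior of $G$. Let $T_{cut}(A)$ be the infimum of the cut tail points of $A$. A family $f=\{f_A\}_{A\in\mathcal A}$ of norms on $\mathbb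 R^d$ with $f_A\le C\|\cdot\|$ for a constant $C$ independent of $A$ is a Lyapunov multinorm of $\{\mathcal A,m,M\}$ if for every nonzero trajectory $x(\cdot)$ and every switching point $\tau$ of its switching law, from a regime $A$ to a regime $A'$, one has $f_A(x(\tau))>\sup_{t} f_{A'}(x(t))$, where $t$ runs from $\tau+m(A')$ to the next switching point (over $[\tau+m(A'),+\infty)$ if there is no next switching point). Then the following holds. (1) The system $\{\mathcal A,m\}$ is stable if and only if every $A\in\mathcal A$ is Hurwitz and the system $\{\mathcal A,m,m+T_{cut}\}$ is stable. (2) If every $A\in\mathcal A$ is Hurwitz, then every Lyapunov multinorm of $\{\mathcal A,m,m+T_{cut}\}$ is also a Lyapunov multinorm of $\{\mathcal A,m\}$. -/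

import Mathlib

open Filter Topology
open scoped Matrix ENNReal

namespace SwitchingSystem

/-- A real square matrix is Hurwitz if all its (complex) eigenvalues have negative real parts. -/
def IsHurwitz {d : ℕ} (A : Matrix (Fin d) (Fin d) ℝ) : Prop :=
  ∀ μ : ℂ, Module.End.HasEigenvalue (Matrix.toLin' (A.map Complex.ofReal)) μ → μ.re < 0

/-- The solution `x(t) = e^{tA} x₀` of `x' = A x`, `x(0) = x₀`. -/
noncomputable def flow {d : ℕ} (A : Matrix (Fin d) (Fin d) ℝ) (x₀ : Fin d → ℝ) (t : ℝ) :
    Fin d → ℝ :=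
  NormedSpace.exp (t • A) *ᵥ x₀

/-- The symmetrized convex hull `co {X, -X}`. -/
def symConvexHull {d : ℕ} (X : Set (Fin d → ℝ)) : Set (Fin d → ℝ) :=
  convexHull ℝ (X ∪ (fun x => -x) '' X)

/-- The symmetrized convex hull of the whole trajectory `{e^{tA} x₀ | t ≥ 0}`. -/
noncomputable def trajectoryHull {d : ℕ} (A : Matrix (Fin d) (Fin d) ℝ) (x₀ : Fin d → ℝ) :
    Set (Fin d → ℝ) :=
  symConvexHull (flow A x₀ '' Set.Ici 0)

/-- `T > 0` is a cut tail point of the trajectory of `A` starting at `x₀`: for all `t ≥ T` the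
point `x(t)` lies in the relative interior of the symmetrized convex hull of the trajectory. -/
def IsCutTailPointOf {d : ℕ} (A : Matrix (Fin d) (Fin d) ℝ) (x₀ : Fin d → ℝ) (T : ℝ) : Prop :=
  0 < T ∧ ∀ t : ℝ, T ≤ t → flow A x₀ t ∈ intrinsicInterior ℝ (trajectoryHull A x₀)

/-- `T > 0` is a cut tail point of the matrix `A`: a cut tail point of all its trajectories. -/
def IsCutTailPoint {d : ℕ} (A : Matrix (Fin d) (Fin d) ℝ) (T : ℝ) : Prop :=
  0 < T ∧ ∀ x₀ : Fin d → ℝ, IsCutTailPointOf A x₀ T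

/-- `T_cut(A)`, the infimum of the cut tail points of the matrix `A`. -/
noncomputable def Tcut {d : ℕ} (A : Matrix (Fin d) (Fin d) ℝ) : ℝ :=
  sInf {T : ℝ | IsCutTailPoint A T}

/-- A switching law: a piecewise constant function of `t ∈ [0, ∞)` that takes the value `regime k`
between `time k` and `time (k + 1)`. The points `time k` with `k ≥ 1` and `time k ≠ ⊤` are
the switching points; there may be infinitely many of them, or finitely many (then all later
entries of `time` are `⊤` and the last switching interval is infinite). They do not accumulate at
a finite point, and the regime really changes at each of them. -/
structure Law (d : ℕ) where
  /-- The successive regimes. -/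
  regime : ℕ → Matrix (Fin d) (Fin d) ℝ
  /-- The starting points of the successive switching intervals. -/
  time : ℕ → ℝ≥0∞
  time_zero : time 0 = 0
  time_mono : Monotone time
  time_lt : ∀ k, time k ≠ ⊤ → time k < time (k + 1)
  time_tendsto : Tendsto time atTop (𝓝 ⊤)
  regime_ne : ∀ k, time (k + 1) ≠ ⊤ → regime (k + 1) ≠ regime k

/-- The switching law belongs to the system `{𝒜, m, M}`: all regimes are from `𝒜`, and each
switching interval of a regime `A` has length at least `m A` and at most `M A` (`⊤` means that
there is no upper bound, and then an infinite switching interval is allowed). -/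
def Law.Admissible {d : ℕ} (σ : Law d) (𝒜 : Set (Matrix (Fin d) (Fin d) ℝ))
    (m : Matrix (Fin d) (Fin d) ℝ → ℝ) (M : Matrix (Fin d) (Fin d) ℝ → ℝ≥0∞) : Prop :=
  ∀ k, σ.time k ≠ ⊤ →
    σ.regime k ∈ 𝒜 ∧
    ENNReal.ofReal (m (σ.regime k)) ≤ σ.time (k + 1) - σ.time k ∧
    σ.time (k + 1) - σ.time k ≤ M (σ.regime k)

/-- `x` is a trajectory for the switching law `A(·)`: it is continuous on `[0, ∞)` and satisfies
`x'(t) = A(t) x(t)` inside each switching interval. -/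
def Law.IsTrajectory {d : ℕ} (σ : Law d) (x : ℝ → Fin d → ℝ) : Prop :=
  ContinuousOn x (Set.Ici 0) ∧
  ∀ (k : ℕ) (t : ℝ), σ.time k < ENNReal.ofReal t → ENNReal.ofReal t < σ.time (k + 1) →
    HasDerivAt x (σ.regime k *ᵥ x t) t

/-- (Asymptotic) stability of the system `{𝒜, m, M}`: all trajectories tend to zero. -/
def Stable {d : ℕ} (𝒜 : Set (Matrix (Fin d) (Fin d) ℝ))
    (m : Matrix (Fin d) (Fin d) ℝ → ℝ) (M : Matrix (Fin d) (Fin d) ℝ → ℝ≥0∞) : Prop :=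
  ∀ σ : Law d, σ.Admissible 𝒜 m M →
    ∀ x : ℝ → Fin d → ℝ, σ.IsTrajectory x → Tendsto x atTop (𝓝 0)

/-- `f = {f_A}` is a Lyapunov multinorm for `{𝒜, m, M}`: a uniformly bounded family of norms such
that for every nonzero trajectory `x` and every switching point `τ` from a regime `A` to a regime
`A'`, the number `f_A (x τ)` is strictly bigger than the supremum of `f_{A'} (x t)` over all `t`
from `τ + m A'` to the next switching point (over all `t ≥ τ + m A'` if there is none). -/
def IsLyapunovMultinorm {d : ℕ} (𝒜 : Set (Matrix (Fin d) (Fin d) ℝ))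
    (m : Matrix (Fin d) (Fin d) ℝ → ℝ) (M : Matrix (Fin d) (Fin d) ℝ → ℝ≥0∞)
    (f : Matrix (Fin d) (Fin d) ℝ → Seminorm ℝ (Fin d → ℝ)) : Prop :=
  (∀ A ∈ 𝒜, ∀ v : Fin d → ℝ, f A v = 0 → v = 0) ∧
  (∃ C : ℝ, ∀ A ∈ 𝒜, ∀ v : Fin d → ℝ, f A v ≤ C * ‖v‖) ∧
  ∀ σ : Law d, σ.Admissible 𝒜 m M →
    ∀ x : ℝ → Fin d → ℝ, σ.IsTrajectory x → x 0 ≠ 0 →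
      ∀ k : ℕ, σ.time (k + 1) ≠ ⊤ →
        ∃ c : ℝ, c < f (σ.regime k) (x (σ.time (k + 1)).toReal) ∧
          ∀ t : ℝ, (σ.time (k + 1)).toReal + m (σ.regime (k + 1)) ≤ t →
            ENNReal.ofReal t ≤ σ.time (k + 2) → f (σ.regime (k + 1)) (x t) ≤ c

end SwitchingSystem

/-! Along a trajectory of a Hurwitz matrix, every seminorm attains its maximum over `t ≥ 0` already
on `[0, Tcut]`. A maximum point `x(t)` with a positive value and `t > Tcut` would be relatively
interior to the hull, so `(1 + ε) x(t)` would lie in the hull, on which the seminorm is at most its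
value at `x(t)`. This is `exists_seminorm_flow_le`, and it turns long switching intervals into short
ones.

Part (2) follows directly: the multinorm inequality concerns one switch only, every nonzero state
occurs at a switch of the bounded system, and the cut tail bound extends the inequality from `[m, m
+ Tcut]` to `[m, ∞)`.

In (1), constant laws show that stability forces Hurwitz regimes. For the converse, the evolution
operators of the finite words of the bounded system are shown to be uniformly bounded
(`exists_evol_bound`) and then exponentially contracting (`exists_exp_clock_bound`). Hence `sup_w
exp(α clock w) ‖evol w v‖`, over the words `w` that may follow a regime, is a Lyapunov function of
regime and state. Applying the cut tail principle to each seminorm `‖evol w ·‖` shows that intervals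
of any length decrease it (`exists_decay_step`).

The difficulty is uniformity: on `𝒜`, `m` need not be bounded away from zero, nor `m` or `Tcut`
bounded above. So time is measured by `clock`, where an interval counts for at most `1`; and for
very short `m` the decrease relies on a positive lower bound for `Tcut` over non-scalar matrices
(`exists_le_Tcut`), scalar ones being explicit. -/

namespace SwitchingSystem

/-! ### The matrix exponential and its flow -/

section

section MatrixNorm
attribute [local instance] Matrix.linftyOpNormedRing Matrix.linftyOpNormedAlgebra

theorem exp_add_smul {d : ℕ} (A : Matrix (Fin d) (Fin d) ℝ) (s t : ℝ) :
    NormedSpace.exp ((s + t) • A) = NormedSpace.exp (s • A) * NormedSpace.exp (t • A) := by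
  rw [add_smul]
  exact Matrix.exp_add_of_commute _ _ (((Commute.refl A).smul_left s).smul_right t)

theorem flow_zero {d : ℕ} (A : Matrix (Fin d) (Fin d) ℝ) (v : Fin d → ℝ) : flow A v 0 = v := by
  simp [flow]

theorem flow_flow {d : ℕ} (A : Matrix (Fin d) (Fin d) ℝ) (v : Fin d → ℝ) (s t : ℝ) :
    flow A (flow A v s) t = flow A v (s + t) := by
  rw [add_comm]
  simp [flow, exp_add_smul]

theorem hasDerivAt_exp_smul {d : ℕ} (A : Matrix (Fin d) (Fin d) ℝ) (t : ℝ) :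
    HasDerivAt (fun t : ℝ => NormedSpace.exp (t • A)) (A * NormedSpace.exp (t • A)) t :=
  hasDerivAt_exp_smul_const' A t

theorem continuous_exp_smul {d : ℕ} (t : ℝ) :
    Continuous (fun A : Matrix (Fin d) (Fin d) ℝ => NormedSpace.exp (t • A)) :=
  NormedSpace.exp_continuous.comp (continuous_const_smul t)

theorem norm_flow_le {d : ℕ} (A : Matrix (Fin d) (Fin d) ℝ) (v : Fin d → ℝ) (t : ℝ) :
    ‖flow A v t‖ ≤ ‖NormedSpace.exp (t • A)‖ * ‖v‖ :=
  Matrix.linfty_opNorm_mulVec _ _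

theorem norm_mulVec_le {d : ℕ} (A : Matrix (Fin d) (Fin d) ℝ) (v : Fin d → ℝ) :
    ‖A *ᵥ v‖ ≤ ‖A‖ * ‖v‖ :=
  Matrix.linfty_opNorm_mulVec _ _

theorem hasDerivAt_flow {d : ℕ} (A : Matrix (Fin d) (Fin d) ℝ) (v : Fin d → ℝ) (t : ℝ) :
    HasDerivAt (flow A v) (A *ᵥ flow A v t) t := by
  have h := hasDerivAt_exp_smul A t
  let L : Matrix (Fin d) (Fin d) ℝ →L[ℝ] (Fin d → ℝ) :=
    LinearMap.toContinuousLinearMap ((Matrix.mulVecBilin ℝ ℝ).flip v)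
  have := L.hasFDerivAt.comp_hasDerivAt t h
  simp [flow, Matrix.mulVec_mulVec]
  exact this

end MatrixNorm

end

/-! ### Estimates and uniqueness for the flow; Hurwitz matrices -/

section

variable {d : ℕ}

theorem flow_add (A : Matrix (Fin d) (Fin d) ℝ) (v w : Fin d → ℝ) (t : ℝ) :
    flow A (v + w) t = flow A v t + flow A w t :=
  Matrix.mulVec_add _ _ _

theorem flow_smul (A : Matrix (Fin d) (Fin d) ℝ) (c : ℝ) (v : Fin d → ℝ) (t : ℝ) :
    flow A (c • v) t = c • flow A v t :=
  Matrix.mulVec_smul _ _ _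

/-- The linear operator `e^{tA}`. -/
noncomputable def flowMap (A : Matrix (Fin d) (Fin d) ℝ) (t : ℝ) :
    (Fin d → ℝ) →ₗ[ℝ] (Fin d → ℝ) :=
  (NormedSpace.exp (t • A)).mulVecLin

@[simp]
theorem flowMap_apply (A : Matrix (Fin d) (Fin d) ℝ) (v : Fin d → ℝ) (t : ℝ) :
    flowMap A t v = flow A v t := rfl

theorem flow_neg_flow (A : Matrix (Fin d) (Fin d) ℝ) (v : Fin d → ℝ) (t : ℝ) :
    flow A (flow A v t) (-t) = v := by
  rw [flow_flow, add_neg_cancel, flow_zero]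

theorem flowMap_injective (A : Matrix (Fin d) (Fin d) ℝ) (t : ℝ) :
    Function.Injective (flowMap A t) :=
  Function.LeftInverse.injective (g := flowMap A (-t)) fun v => flow_neg_flow A v t

theorem continuous_flow (A : Matrix (Fin d) (Fin d) ℝ) (v : Fin d → ℝ) :
    Continuous (flow A v) :=
  continuous_iff_continuousAt.2 fun t => (hasDerivAt_flow A v t).continuousAt

theorem norm_flow_le_exp {A : Matrix (Fin d) (Fin d) ℝ} {R : ℝ}
    (hR : ∀ v : Fin d → ℝ, ‖A *ᵥ v‖ ≤ R * ‖v‖) (v : Fin d → ℝ) {t : ℝ} (ht : 0 ≤ t) :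
    ‖flow A v t‖ ≤ Real.exp (R * t) * ‖v‖ := by
  have := norm_le_gronwallBound_of_norm_deriv_right_le (f := flow A v)
    (f' := fun t => A *ᵥ flow A v t) (δ := ‖v‖) (K := R) (ε := 0) (a := 0) (b := t)
    (continuous_flow A v).continuousOn
    (fun s _ => (hasDerivAt_flow A v s).hasDerivWithinAt)
    (by rw [flow_zero]) (fun s _ => by simpa using hR _) t ⟨ht, le_rfl⟩
  rw [gronwallBound_ε0, sub_zero, mul_comm] at this
  exact this

theorem eq_flow_of_hasDerivAt {A : Matrix (Fin d) (Fin d) ℝ} {x : ℝ → Fin d → ℝ} {a b : ℝ}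
    (hc : ContinuousOn x (Set.Icc a b)) (hd : ∀ t ∈ Set.Ioo a b, HasDerivAt x (A *ᵥ x t) t)
    {t : ℝ} (ht : t ∈ Set.Icc a b) : x t = flow A (x a) (t - a) := by
  rcases (ht.1.trans ht.2).eq_or_lt with rfl | hab
  · obtain rfl : t = a := le_antisymm ht.2 ht.1
    simp [flow_zero]
  -- The equation is known only in the open interval, so uniqueness is anchored at the midpoint and
  -- carried to the endpoints by continuity.
  set c := (a + b) / 2
  have hcm : c ∈ Set.Ioo a b := ⟨by simp only [c]; linarith, by simp only [c]; linarith⟩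
  have hlip : ∀ s ∈ Set.Ioo a b,
      LipschitzOnWith (Real.toNNReal ‖LinearMap.toContinuousLinearMap A.mulVecLin‖)
        (fun y : Fin d → ℝ => A *ᵥ y) Set.univ := by
    intro s _
    have := (LinearMap.toContinuousLinearMap A.mulVecLin).lipschitz.lipschitzOnWith
      (s := Set.univ)
    simpa using! this
  have hdf : ∀ s, HasDerivAt (fun s => flow A (x c) (s - c)) (A *ᵥ flow A (x c) (s - c)) s := by
    intro s
    have := (hasDerivAt_flow A (x c) (s - c)).scomp s ((hasDerivAt_id s).sub_const c)
    rw [one_smul] at this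
    exact this
  have h1 : Set.EqOn x (fun s => flow A (x c) (s - c)) (Set.Ioo a b) :=
    ODE_solution_unique_of_mem_Ioo (v := fun _ y => A *ᵥ y) (s := fun _ => Set.univ) hlip hcm
      (fun s hs => ⟨hd s hs, trivial⟩) (fun s _ => ⟨hdf s, trivial⟩) (by simp [flow_zero])
  have h2 : Set.EqOn x (fun s => flow A (x c) (s - c)) (Set.Icc a b) :=
    h1.of_subset_closure hc
      ((continuous_flow A (x c)).comp (continuous_id.sub continuous_const)).continuousOn
      Set.Ioo_subset_Icc_self (by rw [closure_Ioo hab.ne])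
  rw [h2 ht, h2 ⟨le_rfl, hab.le⟩, flow_flow]
  ring_nf

theorem exists_mulVec_bound {𝒜 : Set (Matrix (Fin d) (Fin d) ℝ)} (h𝒜 : IsCompact 𝒜) :
    ∃ R : ℝ, 0 < R ∧ ∀ A ∈ 𝒜, ∀ v : Fin d → ℝ, ‖A *ᵥ v‖ ≤ R * ‖v‖ := by
  let _ := Matrix.linftyOpNormedRing (n := Fin d) (α := ℝ)
  have hb : Bornology.IsBounded 𝒜 := h𝒜.isBounded
  obtain ⟨R, hR, h⟩ := hb.exists_pos_norm_le
  exact ⟨R, hR, fun A hA v => (norm_mulVec_le A v).trans (by gcongr; exact h A hA)⟩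

theorem norm_flow_sub_le {A : Matrix (Fin d) (Fin d) ℝ} {R C τ : ℝ} (hR0 : 0 ≤ R)
    (hR : ∀ v : Fin d → ℝ, ‖A *ᵥ v‖ ≤ R * ‖v‖) (v : Fin d → ℝ)
    (hC : ∀ t ∈ Set.Icc 0 τ, ‖flow A v t‖ ≤ C * ‖v‖)
    {t : ℝ} (ht : t ∈ Set.Icc 0 τ) : ‖flow A v t - v‖ ≤ R * C * ‖v‖ * t := by
  have := Convex.norm_image_sub_le_of_norm_hasDerivWithin_le (f := flow A v)
    (f' := fun t => A *ᵥ flow A v t) (C := R * C * ‖v‖) (s := Set.Icc 0 τ) (x := 0) (y := t)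
    (fun s _ => (hasDerivAt_flow A v s).hasDerivWithinAt)
    (fun s hs => (hR _).trans (by rw [mul_assoc]; gcongr; exact hC s hs))
    (convex_Icc 0 τ) ⟨le_rfl, ht.1.trans ht.2⟩ ht
  rwa [flow_zero, sub_zero, Real.norm_of_nonneg ht.1] at this

theorem mulVec_flow (A : Matrix (Fin d) (Fin d) ℝ) (v : Fin d → ℝ) (t : ℝ) :
    A *ᵥ flow A v t = flow A (A *ᵥ v) t := by
  have : Commute A (NormedSpace.exp (t • A)) := ((Commute.refl A).smul_right t).exp_right
  simp only [flow, Matrix.mulVec_mulVec, this.eq]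

/-! ### Hurwitz matrices -/

/-- With `N = A - μ`, `e^{tA} = e^{tμ} e^{tN}`, and the series of `e^{tN}` terminates on a
generalized eigenvector. -/
theorem exp_smul_mulVec_of_pow_mulVec_eq_zero {A : Matrix (Fin d) (Fin d) ℂ} {μ : ℂ} {k : ℕ}
    {w : Fin d → ℂ} (hw : ((A - μ • 1) ^ k) *ᵥ w = 0) (t : ℝ) :
    NormedSpace.exp ((t : ℂ) • A) *ᵥ w =
      Complex.exp (t * μ) • ∑ j ∈ Finset.range k,
        ((j.factorial : ℂ)⁻¹ * (t : ℂ) ^ j) • (((A - μ • 1) ^ j) *ᵥ w) := by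
  let _ := Matrix.linftyOpNormedRing (n := Fin d) (α := ℂ)
  let _ := Matrix.linftyOpNormedAlgebra (n := Fin d) (α := ℂ) (R := ℂ)
  set N := A - μ • (1 : Matrix (Fin d) (Fin d) ℂ)
  have hA : (t : ℂ) • A = (t * μ) • (1 : Matrix (Fin d) (Fin d) ℂ) + (t : ℂ) • N := by
    simp [N, smul_sub, smul_smul]
  have hcomm : Commute ((t * μ) • (1 : Matrix (Fin d) (Fin d) ℂ)) ((t : ℂ) • N) :=
    ((Commute.one_left _).smul_left _)
  have h1 : NormedSpace.exp ((t * μ) • (1 : Matrix (Fin d) (Fin d) ℂ)) =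
      Complex.exp (t * μ) • (1 : Matrix (Fin d) (Fin d) ℂ) := by
    have := NormedSpace.algebraMap_exp_comm (𝕂 := ℂ) (𝔸 := Matrix (Fin d) (Fin d) ℂ) (t * μ)
    rw [Algebra.algebraMap_eq_smul_one, Algebra.algebraMap_eq_smul_one] at this
    rw [Complex.exp_eq_exp_ℂ]
    exact this.symm
  rw [hA, Matrix.exp_add_of_commute _ _ hcomm, h1, smul_one_mul, Matrix.smul_mulVec]
  congr 1
  have h2 : HasSum (fun n : ℕ => ((n.factorial : ℂ)⁻¹) • ((t : ℂ) • N) ^ n)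
      (NormedSpace.exp ((t : ℂ) • N)) := NormedSpace.exp_series_hasSum_exp' _
  let L : Matrix (Fin d) (Fin d) ℂ →L[ℂ] (Fin d → ℂ) :=
    LinearMap.toContinuousLinearMap ((Matrix.mulVecBilin ℂ ℂ).flip w)
  have h3 := L.hasSum h2
  have h4 : ∀ n : ℕ, L (((n.factorial : ℂ)⁻¹) • ((t : ℂ) • N) ^ n) =
      ((n.factorial : ℂ)⁻¹ * (t : ℂ) ^ n) • ((N ^ n) *ᵥ w) := by
    intro n
    simp only [L, LinearMap.coe_toContinuousLinearMap', LinearMap.flip_apply,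
      Matrix.mulVecBilin_apply, smul_pow, smul_smul, Matrix.smul_mulVec]
  simp only [h4] at h3
  refine h3.unique (hasSum_sum_of_ne_finset_zero ?_)
  intro n hn
  simp only [Finset.mem_range, not_lt] at hn
  rw [← Nat.sub_add_cancel hn, pow_add N, ← Matrix.mulVec_mulVec, hw, Matrix.mulVec_zero,
    smul_zero]


section
attribute [local instance] Matrix.linftyOpNormedRing Matrix.linftyOpNormedAlgebra

theorem map_ofReal_exp_smul (A : Matrix (Fin d) (Fin d) ℝ) (t : ℝ) :
    (NormedSpace.exp (t • A)).map Complex.ofReal =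
      NormedSpace.exp ((t : ℂ) • A.map Complex.ofReal) := by
  have h := NormedSpace.map_exp (Complex.ofRealHom.mapMatrix (m := Fin d))
    (Continuous.matrix_map continuous_id Complex.continuous_ofReal) (t • A)
  have h2 : (Complex.ofRealHom.mapMatrix (m := Fin d)) (t • A) =
      (t : ℂ) • A.map Complex.ofReal := by
    ext i j
    simp
  rw [h2] at h
  exact h

end

theorem tendsto_exp_smul_mulVec {A : Matrix (Fin d) (Fin d) ℂ} {μ : ℂ} (hμ : μ.re < 0) {k : ℕ}
    {w : Fin d → ℂ} (hw : ((A - μ • 1) ^ k) *ᵥ w = 0) :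
    Tendsto (fun t : ℝ => NormedSpace.exp ((t : ℂ) • A) *ᵥ w) atTop (𝓝 0) := by
  simp_rw [exp_smul_mulVec_of_pow_mulVec_eq_zero hw, Finset.smul_sum, smul_smul]
  rw [show (0 : Fin d → ℂ) = ∑ j ∈ Finset.range k, (0 : ℂ) • (((A - μ • 1) ^ j) *ᵥ w) by simp]
  refine tendsto_finsetSum _ fun j _ => Tendsto.smul_const ?_ _
  rw [tendsto_zero_iff_norm_tendsto_zero]
  have h := (isLittleO_pow_exp_pos_mul_atTop j (neg_pos.2 hμ)).tendsto_div_nhds_zero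
  have h2 := (h.norm).const_mul ‖((j.factorial : ℂ)⁻¹)‖
  rw [norm_zero, mul_zero] at h2
  refine h2.congr fun t => ?_
  rw [norm_mul, norm_mul, Complex.norm_exp, norm_div, Real.norm_of_nonneg (Real.exp_pos _).le,
    norm_pow, norm_pow, Complex.norm_real, Complex.re_ofReal_mul, neg_mul, Real.exp_neg, mul_comm t]
  field_simp

/-- Generalized eigenspaces span the complexified space, and on each of them the flow is an
exponentially small factor times a polynomial in `t`. -/
theorem tendsto_flow_of_isHurwitz {A : Matrix (Fin d) (Fin d) ℝ} (hA : IsHurwitz A)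
    (v : Fin d → ℝ) : Tendsto (flow A v) atTop (𝓝 0) := by
  set B := A.map Complex.ofReal
  have key : ∀ w : Fin d → ℂ,
      Tendsto (fun t : ℝ => NormedSpace.exp ((t : ℂ) • B) *ᵥ w) atTop (𝓝 0) := by
    intro w
    have hw : w ∈ ⨆ μ, Module.End.maxGenEigenspace (Matrix.toLin' B) μ := by
      rw [Module.End.iSup_maxGenEigenspace_eq_top]
      trivial
    induction hw using Submodule.iSup_induction' with
    | mem μ w hw =>
      obtain ⟨k, hk⟩ := (Module.End.mem_maxGenEigenspace _ _ _).1 hw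
      have hpow : ∀ (k : ℕ) (u : Fin d → ℂ), ((Matrix.toLin' B - μ • 1) ^ k) u =
          ((B - μ • 1) ^ k) *ᵥ u := by
        intro k
        induction k with
        | zero => simp
        | succ k ih =>
          intro u
          rw [pow_succ, pow_succ, Module.End.mul_apply, ih, ← Matrix.mulVec_mulVec]
          simp [Matrix.sub_mulVec, Matrix.smul_mulVec]
      rw [hpow] at hk
      by_cases hw0 : w = 0
      · simp [hw0]
      refine tendsto_exp_smul_mulVec (hA μ ?_) hk
      refine (Module.End.hasUnifEigenvalue_iff_hasUnifEigenvalue_one (k := ⊤) (by simp)).1 ?_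
      intro h
      have hbot : Module.End.maxGenEigenspace (Matrix.toLin' B) μ = ⊥ := h
      rw [hbot] at hw
      exact hw0 (by simpa using hw)
    | zero => simp
    | add w₁ w₂ _ _ h₁ h₂ => simpa [Matrix.mulVec_add] using h₁.add h₂
  have h := key (fun i => (v i : ℂ))
  rw [tendsto_pi_nhds] at h ⊢
  intro i
  have h2 := (Complex.continuous_re.tendsto _).comp (h i)
  refine h2.congr fun t => ?_
  simp only [Function.comp_apply, B]
  rw [← map_ofReal_exp_smul]
  simp [flow, Matrix.mulVec, dotProduct]

/-- A complex eigenvector `w` evolves as `e^{tμ} w`; its real and imaginary parts start real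
trajectories, so decay of these forces `μ.re < 0`. -/
theorem isHurwitz_of_tendsto_flow {A : Matrix (Fin d) (Fin d) ℝ}
    (hA : ∀ v, Tendsto (flow A v) atTop (𝓝 0)) : IsHurwitz A := by
  intro μ hμ
  obtain ⟨w, hw⟩ := hμ.exists_hasEigenvector
  set B := A.map Complex.ofReal
  have h1 : ((B - μ • 1) ^ 1) *ᵥ w = 0 := by
    have := hw.apply_eq_smul
    rw [Matrix.toLin'_apply] at this
    rw [pow_one, Matrix.sub_mulVec, this, Matrix.smul_mulVec, Matrix.one_mulVec, sub_self]
  have h2 := exp_smul_mulVec_of_pow_mulVec_eq_zero h1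
  simp only [Finset.range_one, Finset.sum_singleton, Nat.factorial_zero, Nat.cast_one, inv_one,
    pow_zero, mul_one, one_smul, Matrix.one_mulVec] at h2
  have h3 : ∀ t : ℝ, Complex.exp (t * μ) • w =
      (fun i => ((flow A (fun i => (w i).re) t i : ℝ) : ℂ)) +
        Complex.I • (fun i => ((flow A (fun i => (w i).im) t i : ℝ) : ℂ)) := by
    intro t
    rw [← h2 t, ← map_ofReal_exp_smul]
    ext i
    simp only [flow, Matrix.mulVec, dotProduct, Pi.add_apply, Pi.smul_apply, smul_eq_mul,
      Complex.ofReal_sum, Complex.ofReal_mul, Finset.mul_sum, ← Finset.sum_add_distrib,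
      Matrix.map_apply]
    refine Finset.sum_congr rfl fun j _ => ?_
    conv_lhs => rw [← Complex.re_add_im (w j)]
    ring
  obtain ⟨i, hi⟩ := Function.ne_iff.1 hw.2
  have h4 : Tendsto (fun t : ℝ => Complex.exp (t * μ) * w i) atTop (𝓝 0) := by
    have e : ∀ t : ℝ, Complex.exp (t * μ) * w i = ((flow A (fun i => (w i).re) t i : ℝ) : ℂ) +
        Complex.I * ((flow A (fun i => (w i).im) t i : ℝ) : ℂ) := fun t => congrFun (h3 t) i
    simp_rw [e]
    have ha := (Complex.continuous_ofReal.tendsto _).comp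
      ((tendsto_pi_nhds.1 (hA fun i => (w i).re)) i)
    have hb := (Complex.continuous_ofReal.tendsto _).comp
      ((tendsto_pi_nhds.1 (hA fun i => (w i).im)) i)
    simpa using ha.add (hb.const_mul Complex.I)
  by_contra! hre
  have h5 : ∀ᶠ t : ℝ in atTop, ‖Complex.exp (t * μ) * w i‖ < ‖w i‖ := by
    have := h4.norm
    rw [norm_zero] at this
    exact this.eventually_lt_const (norm_pos_iff.2 hi)
  obtain ⟨t, ht, ht0⟩ := (h5.and (eventually_ge_atTop 0)).exists
  rw [norm_mul, Complex.norm_exp, Complex.re_ofReal_mul] at ht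
  have := Real.one_le_exp (mul_nonneg ht0 hre)
  nlinarith [norm_nonneg (w i)]

end

/-! ### Cut tail points and maxima of seminorms -/

section

variable {d : ℕ}

/-- Extract from `S` a basis of its span. The unit `ℓ¹` ball in its coordinates consists of convex
combinations of `0` and vectors `±s`, and it is a neighbourhood of `0` in the span because
coordinates are continuous. -/
theorem exists_nhds_inter_span_subset {E : Type*} [AddCommGroup E] [Module ℝ E]
    [TopologicalSpace E] [IsTopologicalAddGroup E] [ContinuousSMul ℝ E] [T2Space E]
    [FiniteDimensional ℝ E] {S G : Set E} (hG : Convex ℝ G) (hSG : ∀ x ∈ S, x ∈ G ∧ -x ∈ G)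
    (hne : S.Nonempty) : ∃ U ∈ 𝓝 (0 : E), ∀ w ∈ U, w ∈ Submodule.span ℝ S → w ∈ G := by
  obtain ⟨s, hsS, hspan, hli⟩ := exists_linearIndependent ℝ S
  have : Finite s := hli.finite
  have : Fintype s := Fintype.ofFinite s
  let b := Module.Basis.span hli
  have h0 : (0 : E) ∈ G := by
    obtain ⟨x, hx⟩ := hne
    have := hG (hSG x hx).1 (hSG x hx).2 (a := 1 / 2) (b := 1 / 2) (by norm_num) (by norm_num)
      (by norm_num)
    simpa using this
  let p : Submodule.span ℝ (Set.range ((↑) : s → E)) → ℝ := fun w => ∑ i, |b.repr w i|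
  have hp : Continuous p := continuous_finsetSum _ fun i _ =>
    ((b.coord i).continuous_of_finiteDimensional).abs
  have hp0 : ∀ᶠ w in 𝓝 (0 : Submodule.span ℝ (Set.range ((↑) : s → E))), p w < 1 :=
    hp.continuousAt.eventually_lt_const (by simp [p])
  obtain ⟨U, hU, hUp⟩ := (mem_nhds_induced _ _ _).1 hp0
  refine ⟨U, by simpa using hU, fun w hwU hw => ?_⟩
  rw [← hspan] at hw
  have hw' : w ∈ Submodule.span ℝ (Set.range ((↑) : s → E)) := by simpa using hw
  have hpw : p ⟨w, hw'⟩ < 1 := hUp hwU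
  set c := b.repr ⟨w, hw'⟩
  have hwsum : w = ∑ i, c i • (i : E) := by
    have := congrArg (Subtype.val) (b.sum_repr ⟨w, hw'⟩)
    refine this.symm.trans ?_
    simp [b, c, Module.Basis.span_apply]
  rcases (Finset.sum_nonneg fun i _ => abs_nonneg (c i) :
    0 ≤ ∑ i, |c i|).eq_or_lt with hz | hpos
  · have : ∀ i, c i = 0 := fun i => by
      simpa using (Finset.sum_eq_zero_iff_of_nonneg fun i _ => abs_nonneg (c i)).1 hz.symm i
        (Finset.mem_univ i)
    rw [hwsum]
    simpa [this] using h0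
  · set P := ∑ i, |c i|
    have hsgn : ∀ i, (SignType.sign (c i) : ℝ) • (i : E) ∈ G := by
      intro i
      rcases lt_trichotomy (c i) 0 with h | h | h
      · simpa [sign_neg h] using (hSG _ (hsS i.2)).2
      · simpa [h] using h0
      · simpa [sign_pos h] using (hSG _ (hsS i.2)).1
    have hg : ∑ i, (|c i| / P) • ((SignType.sign (c i) : ℝ) • (i : E)) ∈ G :=
      hG.sum_mem (fun i _ => by positivity)
        (by rw [← Finset.sum_div, div_self hpos.ne']) (fun i _ => hsgn i)
    have := hG.smul_mem_of_zero_mem h0 hg ⟨hpos.le, hpw.le⟩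
    rw [hwsum]
    convert! this using 1
    rw [Finset.smul_sum]
    refine Finset.sum_congr rfl fun i _ => ?_
    rw [smul_smul, smul_smul, mul_div_cancel₀ _ hpos.ne', abs_mul_sign]

theorem convex_symConvexHull (X : Set (Fin d → ℝ)) : Convex ℝ (symConvexHull X) :=
  convex_convexHull _ _

theorem mem_symConvexHull {X : Set (Fin d → ℝ)} {x : Fin d → ℝ} (hx : x ∈ X) :
    x ∈ symConvexHull X ∧ -x ∈ symConvexHull X :=
  ⟨subset_convexHull _ _ (Or.inl hx), subset_convexHull _ _ (Or.inr ⟨x, hx, rfl⟩)⟩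

theorem symConvexHull_subset_span (X : Set (Fin d → ℝ)) :
    symConvexHull X ⊆ Submodule.span ℝ X := by
  refine convexHull_min ?_ (Submodule.convex _)
  rintro y (hy | ⟨x, hx, rfl⟩)
  · exact Submodule.subset_span hy
  · exact Submodule.neg_mem _ (Submodule.subset_span hx)

theorem zero_mem_symConvexHull {X : Set (Fin d → ℝ)} (hX : X.Nonempty) :
    0 ∈ symConvexHull X := by
  obtain ⟨x, hx⟩ := hX
  have := convex_symConvexHull X (mem_symConvexHull hx).1 (mem_symConvexHull hx).2
    (a := 1 / 2) (b := 1 / 2) (by norm_num) (by norm_num) (by norm_num)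
  simpa using this

/-- A point `y` of the span near `x` is the midpoint of `2x` and the small vector `2(y - x)`, and
both lie in the hull. -/
theorem mem_intrinsicInterior_of_two_smul_mem {X : Set (Fin d → ℝ)} {x : Fin d → ℝ}
    (hx : (2 : ℝ) • x ∈ symConvexHull X) :
    x ∈ intrinsicInterior ℝ (symConvexHull X) := by
  have hX : X.Nonempty := by
    by_contra h
    rw [Set.not_nonempty_iff_eq_empty] at h
    simp [symConvexHull, h] at hx
  have hconv := convex_symConvexHull X
  obtain ⟨U, hU, hUG⟩ := exists_nhds_inter_span_subset hconv (fun y hy => mem_symConvexHull hy) hX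
  have hxG : x ∈ symConvexHull X := by
    have := hconv.smul_mem_of_zero_mem (zero_mem_symConvexHull hX) hx (t := 1 / 2)
      ⟨by norm_num, by norm_num⟩
    simpa [smul_smul] using this
  rw [mem_intrinsicInterior]
  refine ⟨⟨x, subset_affineSpan ℝ _ hxG⟩, ?_, rfl⟩
  rw [mem_interior_iff_mem_nhds]
  have hcont : Continuous fun y : affineSpan ℝ (symConvexHull X) =>
      (2 : ℝ) • ((y : Fin d → ℝ) - x) := by fun_prop
  have hev := hcont.continuousAt (x := ⟨x, subset_affineSpan ℝ _ hxG⟩)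
  have hev' := hev.eventually (p := fun z => z ∈ U) (by simpa using hU)
  filter_upwards [hev'] with y hy
  have hyspan : (y : Fin d → ℝ) ∈ Submodule.span ℝ X := by
    have hle : affineSpan ℝ (symConvexHull X) ≤ (Submodule.span ℝ X).toAffineSubspace :=
      affineSpan_le.2 (symConvexHull_subset_span X)
    exact hle y.2
  have hmem := hUG _ hy (Submodule.smul_mem _ _
    (Submodule.sub_mem _ hyspan (symConvexHull_subset_span X hxG)))
  have := hconv hx hmem (a := 1 / 2) (b := 1 / 2) (by norm_num) (by norm_num) (by norm_num)
  simpa [smul_smul] using this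

theorem tendsto_exp_smul_of_isHurwitz {A : Matrix (Fin d) (Fin d) ℝ} (hA : IsHurwitz A) :
    Tendsto (fun t : ℝ => NormedSpace.exp (t • A)) atTop (𝓝 0) := by
  refine tendsto_pi_nhds.2 fun i => tendsto_pi_nhds.2 fun j => ?_
  have := tendsto_pi_nhds.1 (tendsto_flow_of_isHurwitz hA (Pi.single j 1)) i
  simpa [flow] using this

/-- Without this the infimum defining `Tcut` could be the default value `0` of the empty set. To get
one `T` for all `x₀`, the hull is taken among matrices: `2 e^{tA}` tends to `0` inside the span of
the matrices `e^{sA}`, so it enters their symmetrized hull, and evaluation at `x₀` maps that hull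
into the trajectory hull. -/
theorem exists_isCutTailPoint {A : Matrix (Fin d) (Fin d) ℝ} (hA : IsHurwitz A) :
    ∃ T, IsCutTailPoint A T := by
  set S : Set (Matrix (Fin d) (Fin d) ℝ) := (fun s : ℝ => NormedSpace.exp (s • A)) '' Set.Ici 0
  have hSG : ∀ x ∈ S, x ∈ convexHull ℝ (S ∪ (fun x => -x) '' S) ∧
      -x ∈ convexHull ℝ (S ∪ (fun x => -x) '' S) := fun x hx =>
    ⟨subset_convexHull _ _ (Or.inl hx), subset_convexHull _ _ (Or.inr ⟨x, hx, rfl⟩)⟩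
  obtain ⟨U, hU, hUG⟩ := exists_nhds_inter_span_subset (convex_convexHull ℝ _) hSG
    ⟨_, 0, Set.self_mem_Ici, rfl⟩
  have h2 := (tendsto_exp_smul_of_isHurwitz hA).const_smul (2 : ℝ)
  rw [smul_zero] at h2
  obtain ⟨T, hT⟩ := eventually_atTop.1 (h2.eventually hU)
  refine ⟨max T 1, by positivity, fun x₀ => ⟨by positivity, fun t ht => ?_⟩⟩
  refine mem_intrinsicInterior_of_two_smul_mem ?_
  have ht0 : 0 ≤ t := zero_le_one.trans ((le_max_right _ _).trans ht)
  have hmem := hUG _ (hT t ((le_max_left _ _).trans ht))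
    (Submodule.smul_mem _ _ (Submodule.subset_span ⟨t, ht0, rfl⟩))
  let L : Matrix (Fin d) (Fin d) ℝ →ₗ[ℝ] (Fin d → ℝ) := (Matrix.mulVecBilin ℝ ℝ).flip x₀
  have himg := Set.mem_image_of_mem L hmem
  rw [L.image_convexHull] at himg
  have hL : L ((2 : ℝ) • NormedSpace.exp (t • A)) = (2 : ℝ) • flow A x₀ t := by
    rw [map_smul]
    rfl
  rw [← hL]
  refine convexHull_mono ?_ himg
  rintro _ ⟨_, ⟨s, hs, rfl⟩ | ⟨_, ⟨s, hs, rfl⟩, rfl⟩, rfl⟩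
  · exact Or.inl ⟨s, hs, rfl⟩
  · exact Or.inr ⟨_, ⟨s, hs, rfl⟩, (map_neg L _).symm⟩

theorem Tcut_nonneg (A : Matrix (Fin d) (Fin d) ℝ) : 0 ≤ Tcut A :=
  Real.sInf_nonneg fun _ hT => hT.1.le

theorem exists_one_add_smul_mem {G : Set (Fin d → ℝ)} (h0 : 0 ∈ G) {x : Fin d → ℝ}
    (hx : x ∈ intrinsicInterior ℝ G) : ∃ ε > (0 : ℝ), (1 + ε) • x ∈ G := by
  obtain ⟨y, hy, rfl⟩ := mem_intrinsicInterior.1 hx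
  let γ : ℝ → affineSpan ℝ G := fun ε =>
    ⟨AffineMap.lineMap (0 : Fin d → ℝ) (y : Fin d → ℝ) (1 + ε),
      AffineMap.lineMap_mem _ (subset_affineSpan ℝ _ h0) y.2⟩
  have hγ : Continuous γ := by
    refine Continuous.subtype_mk ?_ _
    simp only [AffineMap.lineMap_apply_module]
    fun_prop
  have hγ0 : γ 0 = y := by
    ext1
    simp [γ]
  have hev : ∀ᶠ ε in 𝓝 (0 : ℝ), γ ε ∈ ((↑) ⁻¹' G : Set (affineSpan ℝ G)) :=
    hγ.continuousAt.eventually (p := fun z => z ∈ ((↑) ⁻¹' G : Set (affineSpan ℝ G)))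
      (by rw [hγ0]; exact mem_interior_iff_mem_nhds.1 hy)
  obtain ⟨ε, hε, hε0⟩ := ((hev.filter_mono nhdsWithin_le_nhds).and
    (self_mem_nhdsWithin (s := Set.Ioi (0 : ℝ)))).exists
  refine ⟨ε, hε0, ?_⟩
  simpa [γ, AffineMap.lineMap_apply_module] using hε

theorem continuous_seminorm (f : Seminorm ℝ (Fin d → ℝ)) : Continuous f :=
  continuousOn_univ.1 (f.convexOn.continuousOn isOpen_univ)

/-- Along a trajectory of a Hurwitz matrix, every value of a seminorm is bounded by a value taken
before the cut tail time. -/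
theorem exists_seminorm_flow_le {A : Matrix (Fin d) (Fin d) ℝ} (hA : IsHurwitz A)
    (f : Seminorm ℝ (Fin d → ℝ)) (v : Fin d → ℝ) {T : ℝ} (hT0 : 0 ≤ T) (hT : Tcut A ≤ T) :
    ∃ s ∈ Set.Icc 0 T, ∀ t, 0 ≤ t → f (flow A v t) ≤ f (flow A v s) := by
  have hf := continuous_seminorm f
  have hcont : Continuous fun t => f (flow A v t) := hf.comp (continuous_flow A v)
  obtain ⟨s, hs, hmax⟩ := isCompact_Icc.exists_isMaxOn (Set.nonempty_Icc.2 hT0)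
    hcont.continuousOn
  refine ⟨s, hs, ?_⟩
  by_contra! hcon
  obtain ⟨t₀, ht₀, hlt₀⟩ := hcon
  have hpos : 0 < f (flow A v t₀) := (apply_nonneg f _).trans_lt hlt₀
  have hlim : Tendsto (fun t => f (flow A v t)) atTop (𝓝 0) := by
    have := (hf.tendsto 0).comp (tendsto_flow_of_isHurwitz hA v)
    rwa [map_zero] at this
  obtain ⟨b, hb⟩ := eventually_atTop.1 (hlim.eventually_lt_const hpos)
  obtain ⟨t₁, ht₁, hmax₁⟩ := isCompact_Icc.exists_isMaxOn (s := Set.Icc 0 (max b t₀))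
    ⟨t₀, ht₀, le_max_right _ _⟩ hcont.continuousOn
  have hle₀ : f (flow A v t₀) ≤ f (flow A v t₁) := hmax₁ ⟨ht₀, le_max_right _ _⟩
  have hglob : ∀ t, 0 ≤ t → f (flow A v t) ≤ f (flow A v t₁) := by
    intro t ht
    rcases le_total t (max b t₀) with h | h
    · exact hmax₁ ⟨ht, h⟩
    · exact (hb t ((le_max_left _ _).trans h)).le.trans hle₀
  have hTt : T < t₁ := by
    by_contra! h
    exact absurd (hmax ⟨ht₁.1, h⟩) (not_le.2 (hlt₀.trans_le hle₀))
  -- The infimum itself need not be a cut tail point, but the strict inequality `Tcut A < t₁` leaves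
  -- room for one before `t₁`.
  obtain ⟨T', hT', hlt⟩ := exists_lt_of_csInf_lt (s := {T | IsCutTailPoint A T})
    (exists_isCutTailPoint hA) (hT.trans_lt hTt)
  have hrel := (hT'.2 v).2 t₁ hlt.le
  have hne : (flow A v '' Set.Ici 0).Nonempty := ⟨_, 0, Set.self_mem_Ici, rfl⟩
  obtain ⟨ε, hε, hmem⟩ := exists_one_add_smul_mem (zero_mem_symConvexHull hne) hrel
  have hsub : symConvexHull (flow A v '' Set.Ici 0) ⊆ {y | f y ≤ f (flow A v t₁)} := by
    refine convexHull_min ?_ ?_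
    · rintro _ (⟨t, ht, rfl⟩ | ⟨_, ⟨t, ht, rfl⟩, rfl⟩)
      · exact hglob t ht
      · simpa using hglob t ht
    · simpa using f.convexOn.convex_le (f (flow A v t₁))
  have h1 : f ((1 + ε) • flow A v t₁) ≤ f (flow A v t₁) := hsub hmem
  rw [map_smul_eq_mul, Real.norm_of_nonneg (by positivity)] at h1
  nlinarith

end

/-! ### A lower bound for the cut tail time of non-scalar matrices -/

section

variable {d : ℕ}

theorem exists_eq_smul_one_or_linearIndependent (A : Matrix (Fin d) (Fin d) ℝ) :
    (∃ a : ℝ, A = a • 1) ∨ ∃ v : Fin d → ℝ, LinearIndependent ℝ ![v, A *ᵥ v] := by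
  by_contra! h
  obtain ⟨a, ha⟩ := LinearMap.exists_eq_smul_id_of_forall_notLinearIndependent
    (f := Matrix.toLin' A) (fun v => by simpa using h.2 v)
  refine h.1 a ?_
  apply Matrix.toLin'.injective
  rw [ha, map_smul, Matrix.toLin'_one]
  rfl

/-- If `y` is not a multiple of `x`, then some functional vanishing on `x` has norm at most one
and is almost norming on the part of `y` transversal to `x`. -/
theorem exists_functional_almost_norming {x y : Fin d → ℝ} (h : LinearIndependent ℝ ![x, y]) :
    ∃ (g : (Fin d → ℝ) →ₗ[ℝ] ℝ) (z : Fin d → ℝ) (a : ℝ), (∀ u, |g u| ≤ ‖u‖) ∧ g x = 0 ∧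
      0 < g z ∧ ‖z‖ ≤ 2 * g z ∧ y = a • x + z := by
  set S := Submodule.span ℝ {x}
  have : IsClosed (S : Set (Fin d → ℝ)) := S.closed_of_finiteDimensional
  set q : (Fin d → ℝ) ⧸ S := Submodule.Quotient.mk y
  have hq : q ≠ 0 := by
    intro hq
    obtain ⟨a, ha⟩ := Submodule.mem_span_singleton.1 ((Submodule.Quotient.mk_eq_zero S).1 hq)
    have := (LinearIndependent.pair_iff.1 h) a (-1) (by rw [ha]; simp)
    simp at this
  have hpos : 0 < ‖q‖ := norm_pos_iff.2 hq
  obtain ⟨g, hg, hgq⟩ := exists_dual_vector'' ℝ q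
  obtain ⟨z, hz, hzn⟩ := QuotientAddGroup.exists_norm_mk_lt (S := S.toAddSubgroup) q hpos
  have hgz : g (S.mkQ z) = ‖q‖ := by
    have : S.mkQ z = q := hz
    rw [this, hgq]
    rfl
  have hyz : y - z ∈ S := by
    rw [← Submodule.Quotient.eq]
    exact hz.symm
  obtain ⟨a, ha⟩ := Submodule.mem_span_singleton.1 hyz
  refine ⟨g.toLinearMap ∘ₗ S.mkQ, z, a, fun u => ?_, ?_, ?_, ?_, by rw [ha]; simp⟩
  · calc |g (S.mkQ u)| ≤ ‖g‖ * ‖S.mkQ u‖ := g.le_opNorm _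
      _ ≤ 1 * ‖u‖ := by
        gcongr
        exact Submodule.Quotient.norm_mk_le S u
      _ = ‖u‖ := one_mul _
  · have : S.mkQ x = 0 := by
      simp [S, Submodule.mem_span_singleton_self]
    change g (S.mkQ x) = 0
    rw [this, map_zero]
  · change 0 < g (S.mkQ z)
    rw [hgz]
    exact hpos
  · change ‖z‖ ≤ 2 * g (S.mkQ z)
    rw [hgz, two_mul]
    exact hzn.le

/-- The cut tail times of the non-scalar Hurwitz matrices of bounded norm are bounded below. -/
theorem exists_le_Tcut {R : ℝ} (hR0 : 0 < R) : ∃ δ : ℝ, 0 < δ ∧ δ ≤ 1 ∧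
    ∀ A : Matrix (Fin d) (Fin d) ℝ, IsHurwitz A → (∀ v, ‖A *ᵥ v‖ ≤ R * ‖v‖) →
      (∃ a : ℝ, A = a • 1) ∨ δ ≤ Tcut A := by
  -- Small enough that on `[0, 4δ]` the function `g (flow A x t)` stays close to the line `D * t`,
  -- uniformly over all matrices with bound `R`.
  set δ := 1 / (300 * ((R + 1) * Real.exp R))
  have he : 1 ≤ Real.exp R := Real.one_le_exp hR0.le
  have hδ0 : 0 < δ := by positivity
  have hδ : δ * (300 * ((R + 1) * Real.exp R)) = 1 :=
    one_div_mul_cancel (by positivity)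
  have hδR : R * Real.exp R * δ ≤ 1 / 300 := by
    nlinarith [mul_pos hδ0 (Real.exp_pos R)]
  have hδR' : R * δ ≤ 1 / 300 := by nlinarith [mul_pos hR0 hδ0]
  have hδ1 : δ ≤ 1 / 300 := by
    nlinarith [mul_pos hR0 hδ0, mul_le_mul_of_nonneg_left he hδ0.le,
      mul_pos (mul_pos hR0 hδ0) (Real.exp_pos R)]
  refine ⟨δ, hδ0, hδ1.trans (by norm_num), fun A hA hR => ?_⟩
  rcases exists_eq_smul_one_or_linearIndependent A with h | ⟨x, hx⟩
  · exact Or.inl h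
  refine Or.inr ?_
  by_contra! hlt
  obtain ⟨g, z, a, hg, hgx, hz0, hz, hy⟩ := exists_functional_almost_norming hx
  set D := g z
  have hx0 : 0 < ‖x‖ := norm_pos_iff.2 (by simpa using hx.ne_zero 0)
  have hDx : D ≤ R * ‖x‖ := by
    have : g (A *ᵥ x) = D := by rw [hy, map_add, map_smul, hgx, smul_zero, zero_add]
    rw [← this]
    exact (le_abs_self _).trans ((hg _).trans (hR x))
  have ha : |a| ≤ 3 * R := by
    have h1 : a • x = A *ᵥ x - z := by rw [hy]; simp
    have h2 : |a| * ‖x‖ ≤ R * ‖x‖ + 2 * D := by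
      rw [← Real.norm_eq_abs, ← norm_smul, h1]
      exact (norm_sub_le _ _).trans (add_le_add (hR x) hz)
    nlinarith
  -- If `Tcut A < δ`, then `|g|` is maximal along the trajectory somewhere in `[0, δ]`. But it
  -- starts at `0` and grows at a rate close to `D`, so it is larger at `4δ`.
  let f : Seminorm ℝ (Fin d → ℝ) := (normSeminorm ℝ ℝ).comp g
  obtain ⟨s, hs, hmax⟩ := exists_seminorm_flow_le hA f x hδ0.le hlt.le
  have hmax' : ∀ t, 0 ≤ t → |g (flow A x t)| ≤ |g (flow A x s)| := hmax
  set Φ := |g (flow A x s)|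
  have hΦ : 0 ≤ Φ := abs_nonneg _
  have hderiv : ∀ t, HasDerivAt (fun t => g (flow A x t) - D * t)
      (a * g (flow A x t) + (g (flow A z t) - D)) t := by
    intro t
    have h1 := (LinearMap.toContinuousLinearMap g).hasFDerivAt.comp_hasDerivAt t
      (hasDerivAt_flow A x t)
    have h2 := h1.sub ((hasDerivAt_id t).const_mul D)
    refine h2.congr_deriv ?_
    simp only [LinearMap.coe_toContinuousLinearMap', mulVec_flow, mul_one]
    rw [hy, flow_add, flow_smul, map_add, map_smul, smul_eq_mul]
    ring
  have hbd : ∀ t ∈ Set.Icc 0 (4 * δ),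
      ‖a * g (flow A x t) + (g (flow A z t) - D)‖ ≤ 3 * R * Φ + D / 4 := by
    intro t ht
    refine (norm_add_le _ _).trans (add_le_add ?_ ?_)
    · rw [norm_mul]
      exact mul_le_mul ha (hmax' t ht.1) (norm_nonneg _) (by positivity)
    · have h1 := norm_flow_sub_le (C := Real.exp R) (τ := 4 * δ) hR0.le hR z
        (fun t ht => (norm_flow_le_exp hR z ht.1).trans (by
          gcongr
          nlinarith [ht.2])) ht
      have h2 : g (flow A z t) - D = g (flow A z t - z) := by rw [map_sub]
      rw [h2]
      refine (hg _).trans (h1.trans ?_)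
      have h3 : R * Real.exp R * ‖z‖ * t ≤ (R * Real.exp R) * (2 * D) * (4 * δ) := by
        have := ht.1
        gcongr
        exact ht.2
      nlinarith
  have hmv : ∀ t ∈ Set.Icc 0 (4 * δ), |g (flow A x t) - D * t| ≤ (3 * R * Φ + D / 4) * t := by
    intro t ht
    have := Convex.norm_image_sub_le_of_norm_hasDerivWithin_le
      (fun t _ => (hderiv t).hasDerivWithinAt) hbd (convex_Icc 0 (4 * δ))
      (x := 0) (y := t) ⟨le_rfl, ht.1.trans ht.2⟩ ht
    rw [flow_zero, hgx, sub_zero, mul_zero, sub_zero, sub_zero, Real.norm_of_nonneg ht.1] at this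
    exact this
  have hs4 : s ∈ Set.Icc 0 (4 * δ) := ⟨hs.1, by linarith [hs.2]⟩
  have h1 := hmv s hs4
  have h2 := hmv (4 * δ) ⟨by positivity, le_rfl⟩
  have h3 := hmax' (4 * δ) (by positivity)
  have h4 : Φ ≤ (3 * R * Φ + D / 4 + D) * δ := by
    have e1 : Φ ≤ |g (flow A x s) - D * s| + D * s := by
      have := abs_add_le (g (flow A x s) - D * s) (D * s)
      rwa [sub_add_cancel, abs_of_nonneg (mul_nonneg hz0.le hs.1)] at this
    have e2 : (3 * R * Φ + D / 4 + D) * s ≤ (3 * R * Φ + D / 4 + D) * δ := by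
      gcongr
      exact hs.2
    linarith
  have h5 : D * (4 * δ) - (3 * R * Φ + D / 4) * (4 * δ) ≤ Φ := by
    have := (abs_le.1 h2).1
    have := (abs_le.1 h3).2
    linarith
  have h6 : R * δ * Φ ≤ 1 / 300 * Φ := by gcongr
  have h7 : 0 < D * δ := mul_pos hz0 hδ0
  nlinarith

end

/-! ### Construction and structure of switching laws -/

section

variable {d : ℕ}

/-- The starting points of switching intervals with lengths `s 0, s 1, …`. -/
noncomputable def startTime (s : ℕ → ℝ) (k : ℕ) : ℝ := ∑ i ∈ Finset.range k, s i

theorem startTime_succ (s : ℕ → ℝ) (k : ℕ) : startTime s (k + 1) = startTime s k + s k :=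
  Finset.sum_range_succ _ _

theorem startTime_zero (s : ℕ → ℝ) : startTime s 0 = 0 := by simp [startTime]

theorem strictMono_startTime {s : ℕ → ℝ} (hs : ∀ k, 0 < s k) : StrictMono (startTime s) :=
  strictMono_nat_of_lt_succ fun k => by rw [startTime_succ]; linarith [hs k]

theorem startTime_nonneg {s : ℕ → ℝ} (hs : ∀ k, 0 < s k) (k : ℕ) : 0 ≤ startTime s k :=
  Finset.sum_nonneg fun i _ => (hs i).le

/-- The switching law with regimes `A k` on successive intervals of lengths `s k`. -/
noncomputable def lawOf (A : ℕ → Matrix (Fin d) (Fin d) ℝ) (s : ℕ → ℝ) (hs : ∀ k, 0 < s k)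
    (hlim : Tendsto (startTime s) atTop atTop) (hne : ∀ k, A (k + 1) ≠ A k) : Law d where
  regime := A
  time k := ENNReal.ofReal (startTime s k)
  time_zero := by simp [startTime_zero]
  time_mono := fun _ _ h => ENNReal.ofReal_le_ofReal ((strictMono_startTime hs).monotone h)
  time_lt k _ := (ENNReal.ofReal_lt_ofReal_iff_of_nonneg (startTime_nonneg hs k)).2
    (strictMono_startTime hs k.lt_succ_self)
  time_tendsto := ENNReal.tendsto_ofReal_atTop.comp hlim
  regime_ne k _ := hne k

theorem lawOf_admissible {A : ℕ → Matrix (Fin d) (Fin d) ℝ} {s : ℕ → ℝ} (hs : ∀ k, 0 < s k)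
    (hlim : Tendsto (startTime s) atTop atTop) (hne : ∀ k, A (k + 1) ≠ A k)
    {𝒜 : Set (Matrix (Fin d) (Fin d) ℝ)} {m N : Matrix (Fin d) (Fin d) ℝ → ℝ}
    (h𝒜 : ∀ k, A k ∈ 𝒜) (hm : ∀ k, m (A k) ≤ s k) (hN : ∀ k, s k ≤ N (A k)) :
    (lawOf A s hs hlim hne).Admissible 𝒜 m (fun A => ENNReal.ofReal (N A)) := by
  intro k _
  have h : (lawOf A s hs hlim hne).time (k + 1) - (lawOf A s hs hlim hne).time k =
      ENNReal.ofReal (s k) := by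
    simp only [lawOf]
    rw [← ENNReal.ofReal_sub _ (startTime_nonneg hs k), startTime_succ, add_sub_cancel_left]
  rw [h]
  exact ⟨h𝒜 k, ENNReal.ofReal_le_ofReal (hm k), ENNReal.ofReal_le_ofReal (hN k)⟩

/-- The states at the switching points. -/
noncomputable def switchState (A : ℕ → Matrix (Fin d) (Fin d) ℝ) (s : ℕ → ℝ) (v : Fin d → ℝ) :
    ℕ → Fin d → ℝ
  | 0 => v
  | k + 1 => flow (A k) (switchState A s v k) (s k)

theorem exists_isTrajectory_lawOf (A : ℕ → Matrix (Fin d) (Fin d) ℝ) (s : ℕ → ℝ)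
    (hs : ∀ k, 0 < s k) (hlim : Tendsto (startTime s) atTop atTop) (hne : ∀ k, A (k + 1) ≠ A k)
    (v : Fin d → ℝ) :
    ∃ x, (lawOf A s hs hlim hne).IsTrajectory x ∧
      ∀ k, ∀ t ∈ Set.Icc (startTime s k) (startTime s (k + 1)),
        x t = flow (A k) (switchState A s v k) (t - startTime s k) := by
  classical
  have hmono := strictMono_startTime hs
  have hex : ∀ t : ℝ, ∃ k, t < startTime s (k + 1) := fun t =>
    (((tendsto_add_atTop_iff_nat 1).2 hlim).eventually_gt_atTop t).exists
  let x : ℝ → Fin d → ℝ := fun t => flow (A (Nat.find (hex t)))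
    (switchState A s v (Nat.find (hex t))) (t - startTime s (Nat.find (hex t)))
  have hfind : ∀ k t, startTime s k ≤ t → t < startTime s (k + 1) → Nat.find (hex t) = k := by
    intro k t h1 h2
    rw [Nat.find_eq_iff]
    exact ⟨h2, fun j hj => not_lt.2 ((hmono.monotone hj).trans h1)⟩
  have hx : ∀ k, ∀ t ∈ Set.Icc (startTime s k) (startTime s (k + 1)),
      x t = flow (A k) (switchState A s v k) (t - startTime s k) := by
    intro k t ht
    rcases ht.2.lt_or_eq with h | h
    · simp only [x, hfind k t ht.1 h]
    · have h' : t < startTime s (k + 1 + 1) := h.trans_lt (hmono (k + 1).lt_succ_self)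
      simp only [x, hfind (k + 1) t h.ge h']
      rw [h, sub_self, flow_zero, startTime_succ, add_sub_cancel_left]
      rfl
  refine ⟨x, ⟨?_, ?_⟩, hx⟩
  · have hlf : LocallyFinite fun k => Set.Icc (startTime s k) (startTime s (k + 1)) := by
      intro t
      refine ⟨Set.Iio (t + 1), Iio_mem_nhds (by linarith), ?_⟩
      obtain ⟨N, hN⟩ := eventually_atTop.1 (hlim.eventually_ge_atTop (t + 1))
      refine (Set.finite_Iio N).subset ?_
      rintro k ⟨u, hu, hut⟩
      by_contra hk
      exact absurd (hu.1.trans_lt hut) (not_lt.2 (hN k (not_lt.1 hk)))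
    refine (hlf.continuousOn_iUnion (fun k => isClosed_Icc) fun k => ?_).mono ?_
    · exact (((continuous_flow (A k) (switchState A s v k)).comp
        (continuous_id.sub continuous_const)).continuousOn).congr (hx k)
    · intro t ht
      refine Set.mem_iUnion.2 ⟨Nat.find (hex t), ?_, (Nat.find_spec (hex t)).le⟩
      rcases Nat.eq_zero_or_pos (Nat.find (hex t)) with h | h
      · rw [h, startTime_zero]
        exact ht
      · have := Nat.find_min (hex t) (Nat.sub_lt h one_pos)
        rw [(by omega : Nat.find (hex t) - 1 + 1 = Nat.find (hex t))] at this
        exact not_lt.1 this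
  · intro k t h1 h2
    simp only [lawOf] at h1 h2 ⊢
    have h1' : startTime s k < t := (ENNReal.ofReal_lt_ofReal_iff_of_nonneg
      (startTime_nonneg hs k)).1 h1
    have h2' : t < startTime s (k + 1) := (ENNReal.ofReal_lt_ofReal_iff_of_nonneg
      ((startTime_nonneg hs k).trans h1'.le)).1 h2
    have hev : x =ᶠ[𝓝 t] fun t => flow (A k) (switchState A s v k) (t - startTime s k) := by
      filter_upwards [Ioo_mem_nhds h1' h2'] with u hu
      exact hx k u ⟨hu.1.le, hu.2.le⟩
    have hd := (hasDerivAt_flow (A k) (switchState A s v k) (t - startTime s k)).scomp t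
      ((hasDerivAt_id t).sub_const (startTime s k))
    rw [one_smul, ← hx k t ⟨h1'.le, h2'.le⟩] at hd
    exact hd.congr_of_eventuallyEq hev

/-- A trajectory follows the flow of the current regime on each switching interval. -/
theorem Law.IsTrajectory.eq_flow {σ : Law d} {x : ℝ → Fin d → ℝ} (hx : σ.IsTrajectory x) {k : ℕ}
    (hk : σ.time k ≠ ⊤) {t : ℝ} (h1 : (σ.time k).toReal ≤ t)
    (h2 : ENNReal.ofReal t ≤ σ.time (k + 1)) :
    x t = flow (σ.regime k) (x (σ.time k).toReal) (t - (σ.time k).toReal) := by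
  have h0 : 0 ≤ (σ.time k).toReal := ENNReal.toReal_nonneg
  refine eq_flow_of_hasDerivAt (b := t) (hx.1.mono fun u hu => h0.trans hu.1) (fun u hu => ?_)
    ⟨h1, le_rfl⟩
  refine hx.2 k u ?_ ?_
  · exact (ENNReal.lt_ofReal_iff_toReal_lt hk).2 hu.1
  · refine lt_of_lt_of_le ?_ h2
    exact (ENNReal.ofReal_lt_ofReal_iff_of_nonneg (h0.trans hu.1.le)).2 hu.2

/-- The switching law without switching points. -/
noncomputable def constLaw (A : Matrix (Fin d) (Fin d) ℝ) : Law d where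
  regime _ := A
  time k := if k = 0 then 0 else ⊤
  time_zero := by simp
  time_mono := by
    intro i j h
    by_cases hj : j = 0
    · have : i = 0 := by omega
      simp [this]
    · simp [hj]
  time_lt k hk := by
    have : k = 0 := by by_contra h; simp [h] at hk
    simp [this]
  time_tendsto := tendsto_const_nhds.congr' (by
    filter_upwards [eventually_ge_atTop 1] with k hk
    simp [Nat.one_le_iff_ne_zero.1 hk])
  regime_ne k hk := by simp at hk

theorem isHurwitz_of_stable {𝒜 : Set (Matrix (Fin d) (Fin d) ℝ)}
    {m : Matrix (Fin d) (Fin d) ℝ → ℝ} (h : Stable 𝒜 m (fun _ => ⊤))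
    {A : Matrix (Fin d) (Fin d) ℝ} (hA : A ∈ 𝒜) : IsHurwitz A := by
  refine isHurwitz_of_tendsto_flow fun v => h (constLaw A) ?_ _ ⟨(continuous_flow A v).continuousOn,
    fun k t _ _ => hasDerivAt_flow A v t⟩
  intro k hk
  have : k = 0 := by by_contra h; simp [constLaw, h] at hk
  subst this
  simp [constLaw, hA]

theorem Law.Admissible.mono {σ : Law d} {𝒜 : Set (Matrix (Fin d) (Fin d) ℝ)}
    {m : Matrix (Fin d) (Fin d) ℝ → ℝ} {M M' : Matrix (Fin d) (Fin d) ℝ → ℝ≥0∞}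
    (h : σ.Admissible 𝒜 m M) (hM : ∀ A, M A ≤ M' A) : σ.Admissible 𝒜 m M' :=
  fun k hk => ⟨(h k hk).1, (h k hk).2.1, (h k hk).2.2.trans (hM _)⟩

theorem Stable.mono {𝒜 : Set (Matrix (Fin d) (Fin d) ℝ)}
    {m : Matrix (Fin d) (Fin d) ℝ → ℝ} {M M' : Matrix (Fin d) (Fin d) ℝ → ℝ≥0∞}
    (h : Stable 𝒜 m M') (hM : ∀ A, M A ≤ M' A) : Stable 𝒜 m M :=
  fun σ hσ => h σ (hσ.mono hM)

end

/-! ### Lyapunov multinorms -/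

section

variable {d : ℕ}

theorem tendsto_startTime_of_le {s : ℕ → ℝ} {c : ℝ} (hc : 0 < c) (hs : ∀ k, c ≤ s k) :
    Tendsto (startTime s) atTop atTop := by
  have h : ∀ k : ℕ, (k : ℝ) * c ≤ startTime s k := by
    intro k
    have := Finset.card_nsmul_le_sum (Finset.range k) s c (fun i _ => hs i)
    simpa [startTime] using this
  exact tendsto_atTop_mono h (tendsto_natCast_atTop_atTop.atTop_mul_const hc)

theorem Law.time_ne_top_of_succ (σ : Law d) {k : ℕ} (hk : σ.time (k + 1) ≠ ⊤) :
    σ.time k ≠ ⊤ :=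
  ne_top_of_le_ne_top hk (σ.time_mono k.le_succ)

theorem Law.IsTrajectory.eq_flow_succ {σ : Law d} {x : ℝ → Fin d → ℝ} (hx : σ.IsTrajectory x)
    {k : ℕ} (hk : σ.time (k + 1) ≠ ⊤) :
    x (σ.time (k + 1)).toReal = flow (σ.regime k) (x (σ.time k).toReal)
      ((σ.time (k + 1)).toReal - (σ.time k).toReal) :=
  hx.eq_flow (σ.time_ne_top_of_succ hk) (ENNReal.toReal_mono hk (σ.time_mono k.le_succ))
    (ENNReal.ofReal_toReal hk).le

theorem Law.IsTrajectory.ne_zero {σ : Law d} {x : ℝ → Fin d → ℝ} (hx : σ.IsTrajectory x)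
    (h0 : x 0 ≠ 0) : ∀ {k : ℕ}, σ.time k ≠ ⊤ → x (σ.time k).toReal ≠ 0
  | 0, _ => by simpa [σ.time_zero] using h0
  | k + 1, hk => by
    rw [hx.eq_flow_succ hk, ← flowMap_apply]
    exact (map_ne_zero_iff _ (flowMap_injective _ _)).2
      (hx.ne_zero h0 (σ.time_ne_top_of_succ hk))

/-- The defining inequality of a Lyapunov multinorm at one switch, for a system with bounded
switching intervals. -/
theorem IsLyapunovMultinorm.exists_lt_of_switch {𝒜 : Set (Matrix (Fin d) (Fin d) ℝ)}
    {m N : Matrix (Fin d) (Fin d) ℝ → ℝ} (hm : ∀ A ∈ 𝒜, 0 < m A) (hN : ∀ A ∈ 𝒜, m A ≤ N A)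
    {f : Matrix (Fin d) (Fin d) ℝ → Seminorm ℝ (Fin d → ℝ)}
    (hf : IsLyapunovMultinorm 𝒜 m (fun A => ENNReal.ofReal (N A)) f)
    {A A' : Matrix (Fin d) (Fin d) ℝ} (hA : A ∈ 𝒜) (hA' : A' ∈ 𝒜) (hne : A' ≠ A)
    {y : Fin d → ℝ} (hy : y ≠ 0) :
    ∃ c, c < f A y ∧ ∀ u ∈ Set.Icc (m A') (N A'), f A' (flow A' y u) ≤ c := by
  -- The alternating law with longest possible intervals realises both regimes; the longest interval
  -- of `A'` makes every `u` up to `N A'` visible.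
  let r : ℕ → Matrix (Fin d) (Fin d) ℝ := fun k => if Even k then A else A'
  have hr : ∀ k, r k = A ∨ r k = A' := fun k => by
    simp only [r]
    split_ifs <;> simp
  have hr𝒜 : ∀ k, r k ∈ 𝒜 := fun k => by
    rcases hr k with h | h <;> rw [h] <;> assumption
  let s : ℕ → ℝ := fun k => N (r k)
  have hNA : 0 < N A := (hm A hA).trans_le (hN A hA)
  have hNA' : 0 < N A' := (hm A' hA').trans_le (hN A' hA')
  have hmin : ∀ k, min (N A) (N A') ≤ s k := fun k => by
    simp only [s]
    rcases hr k with h | h <;> rw [h] <;> simp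
  have hmin0 : 0 < min (N A) (N A') := lt_min hNA hNA'
  have hs : ∀ k, 0 < s k := fun k => hmin0.trans_le (hmin k)
  have hlim := tendsto_startTime_of_le hmin0 hmin
  have hrne : ∀ k, r (k + 1) ≠ r k := fun k => by
    simp only [r, Nat.even_add_one]
    split_ifs with h
    · exact hne
    · exact hne.symm
  have hadm := lawOf_admissible (m := m) (N := N) hs hlim hrne hr𝒜 (fun k => hN _ (hr𝒜 k))
    (fun k => le_rfl)
  -- Running backwards from `y` gives the initial point whose state at the first switch is `y`.
  set v := flow A y (-(N A))
  obtain ⟨z, hz, hzx⟩ := exists_isTrajectory_lawOf r s hs hlim hrne v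
  have hr0 : r 0 = A := by simp [r]
  have hr1 : r 1 = A' := by simp [r]
  have hs0 : s 0 = N A := by simp [s, hr0]
  have hs1 : s 1 = N A' := by simp [s, hr1]
  have hst : switchState r s v 1 = y := by
    change flow (r 0) v (s 0) = y
    rw [hr0, hs0, flow_flow, neg_add_cancel, flow_zero]
  have hzy : ∀ u ∈ Set.Icc 0 (N A'), z (startTime s 1 + u) = flow A' y u := by
    intro u hu
    rw [hzx 1 _ ⟨by linarith [hu.1], by rw [startTime_succ s 1, hs1]; linarith [hu.2]⟩, hst, hr1,
      add_sub_cancel_left]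
  have hz0 : z 0 ≠ 0 := by
    have := hzx 0 0 ⟨(startTime_zero s).le, startTime_nonneg hs _⟩
    rw [this, startTime_zero, sub_self, flow_zero]
    exact (map_ne_zero_iff _ (flowMap_injective A _)).2 hy
  obtain ⟨c, hc, hle⟩ := hf.2.2 _ hadm z hz hz0 0 ENNReal.ofReal_ne_top
  have ht1 : (ENNReal.ofReal (startTime s (0 + 1))).toReal = startTime s 1 :=
    ENNReal.toReal_ofReal (startTime_nonneg hs _)
  simp only [lawOf, ht1] at hc hle
  refine ⟨c, ?_, fun u hu => ?_⟩
  · have h1 := hzy 0 ⟨le_rfl, hNA'.le⟩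
    rw [add_zero, flow_zero] at h1
    rwa [h1, hr0] at hc
  · have := hle (startTime s 1 + u) (by rw [zero_add, hr1]; linarith [hu.1])
      (ENNReal.ofReal_le_ofReal (by
        rw [zero_add, show (2 : ℕ) = 1 + 1 from rfl, startTime_succ s 1, hs1]
        linarith [hu.2]))
    rwa [zero_add, hr1, hzy u ⟨(hm A' hA').le.trans hu.1, hu.2⟩] at this

theorem IsLyapunovMultinorm.of_cut_tail {𝒜 : Set (Matrix (Fin d) (Fin d) ℝ)}
    {m : Matrix (Fin d) (Fin d) ℝ → ℝ} (hm : ∀ A ∈ 𝒜, 0 < m A) (hH : ∀ A ∈ 𝒜, IsHurwitz A)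
    {f : Matrix (Fin d) (Fin d) ℝ → Seminorm ℝ (Fin d → ℝ)}
    (hf : IsLyapunovMultinorm 𝒜 m (fun A => ENNReal.ofReal (m A + Tcut A)) f) :
    IsLyapunovMultinorm 𝒜 m (fun _ => ⊤) f := by
  refine ⟨hf.1, hf.2.1, fun σ hσ x hx hx0 k hk => ?_⟩
  have hA := (hσ k (σ.time_ne_top_of_succ hk)).1
  have hA' := (hσ (k + 1) hk).1
  obtain ⟨c, hc, hle⟩ := hf.exists_lt_of_switch (N := fun A => m A + Tcut A) hm
    (fun A _ => by simpa using Tcut_nonneg A) hA hA' (σ.regime_ne k hk) (hx.ne_zero hx0 hk)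
  refine ⟨c, hc, fun t ht1 ht2 => ?_⟩
  have hmA' := hm _ hA'
  rw [hx.eq_flow hk (by linarith) ht2]
  set A' := σ.regime (k + 1)
  set y := x (σ.time (k + 1)).toReal
  -- The cut tail principle is applied after the compulsory time `m A'`, so the competing time lies
  -- in `[m A', m A' + Tcut A']`.
  obtain ⟨s, hs, hmax⟩ := exists_seminorm_flow_le (hH A' hA') (f A') (flow A' y (m A'))
    (Tcut_nonneg A') le_rfl
  have h1 := hmax (t - (σ.time (k + 1)).toReal - m A') (by linarith)
  rw [flow_flow, flow_flow, add_sub_cancel] at h1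
  exact h1.trans (hle _ ⟨by linarith [hs.1], by linarith [hs.2]⟩)

end

/-! ### Uniform bounds over a compact set of regimes -/

section

variable {d : ℕ}

section
attribute [local instance] Matrix.linftyOpNormedRing Matrix.linftyOpNormedAlgebra

/-- Each Hurwitz matrix contracts by one half at some time `T`; the same `T` works nearby by
continuity of the exponential, and compactness bounds these times. -/
theorem exists_uniform_contraction {𝒜 : Set (Matrix (Fin d) (Fin d) ℝ)} (h𝒜 : IsCompact 𝒜)
    (hH : ∀ A ∈ 𝒜, IsHurwitz A) :
    ∃ T₀ > (0 : ℝ), ∀ A ∈ 𝒜, ∃ T ∈ Set.Ioc 0 T₀, ∀ v, ‖flow A v T‖ ≤ 1 / 2 * ‖v‖ := by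
  refine h𝒜.induction_on (p := fun s => ∃ T₀ > (0 : ℝ), ∀ A ∈ s, ∃ T ∈ Set.Ioc 0 T₀,
    ∀ v, ‖flow A v T‖ ≤ 1 / 2 * ‖v‖) ⟨1, one_pos, by simp⟩ ?_ ?_ ?_
  · rintro s t hst ⟨T, hT, h⟩
    exact ⟨T, hT, fun A hA => h A (hst hA)⟩
  · rintro s t ⟨T₁, hT₁, h₁⟩ ⟨T₂, hT₂, h₂⟩
    refine ⟨max T₁ T₂, lt_max_of_lt_left hT₁, ?_⟩
    rintro A (hA | hA)
    · obtain ⟨T, hT, h⟩ := h₁ A hA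
      exact ⟨T, ⟨hT.1, hT.2.trans (le_max_left _ _)⟩, h⟩
    · obtain ⟨T, hT, h⟩ := h₂ A hA
      exact ⟨T, ⟨hT.1, hT.2.trans (le_max_right _ _)⟩, h⟩
  · intro A hA
    have h1 := (tendsto_exp_smul_of_isHurwitz (hH A hA)).norm
    rw [norm_zero] at h1
    obtain ⟨T, hT, hT0⟩ := ((h1.eventually_lt_const (show (0 : ℝ) < 1 / 2 by norm_num)).and
      (eventually_gt_atTop 0)).exists
    have h2 : Continuous fun B : Matrix (Fin d) (Fin d) ℝ => ‖NormedSpace.exp (T • B)‖ :=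
      continuous_norm.comp (continuous_exp_smul T)
    refine ⟨_, mem_nhdsWithin_of_mem_nhds (h2.continuousAt.eventually_lt_const hT), T, hT0,
      fun B hB => ⟨T, ⟨hT0, le_rfl⟩, fun v => (norm_flow_le B v T).trans ?_⟩⟩
    have hB' : ‖NormedSpace.exp (T • B)‖ < 1 / 2 := hB
    gcongr

end

theorem norm_flow_le_of_contraction {A : Matrix (Fin d) (Fin d) ℝ} {R T T₀ : ℝ} (hR0 : 0 ≤ R)
    (hR : ∀ v : Fin d → ℝ, ‖A *ᵥ v‖ ≤ R * ‖v‖) (hT : T ∈ Set.Ioc 0 T₀)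
    (hAT : ∀ v, ‖flow A v T‖ ≤ 1 / 2 * ‖v‖) (v : Fin d → ℝ) {t : ℝ} (ht : 0 ≤ t) :
    ‖flow A v t‖ ≤ Real.exp (R * T₀) * ‖v‖ := by
  have key : ∀ (n : ℕ) (v : Fin d → ℝ) (t : ℝ), 0 ≤ t → t ≤ n * T →
      ‖flow A v t‖ ≤ Real.exp (R * T₀) * ‖v‖ := by
    intro n
    induction n with
    | zero =>
      intro v t h0 h1
      obtain rfl : t = 0 := le_antisymm (by simpa using h1) h0
      rw [flow_zero]
      exact le_mul_of_one_le_left (norm_nonneg _)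
        (Real.one_le_exp (mul_nonneg hR0 (hT.1.le.trans hT.2)))
    | succ n ih =>
      intro v t h0 h1
      rcases le_total t T with h | h
      · refine (norm_flow_le_exp hR v h0).trans ?_
        gcongr
        exact h.trans hT.2
      · have h2 := ih (flow A v T) (t - T) (by linarith) (by push_cast at h1; linarith)
        rw [flow_flow, add_sub_cancel] at h2
        refine h2.trans ?_
        gcongr
        exact (hAT v).trans (by linarith [norm_nonneg v])
  obtain ⟨n, hn⟩ := exists_nat_ge (t / T)
  exact key n v t ht ((div_le_iff₀ hT.1).1 hn)

theorem flow_smul_one (a : ℝ) (v : Fin d → ℝ) (t : ℝ) :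
    flow (a • (1 : Matrix (Fin d) (Fin d) ℝ)) v t = Real.exp (a * t) • v := by
  have hd : ∀ u, HasDerivAt (fun t => Real.exp (a * t) • v)
      ((a • (1 : Matrix (Fin d) (Fin d) ℝ)) *ᵥ (Real.exp (a * u) • v)) u := by
    intro u
    have h1 := (((hasDerivAt_id u).const_mul a).exp).smul_const v
    refine h1.congr_deriv ?_
    simp [Matrix.smul_mulVec, smul_smul, mul_comm]
  rcases le_total 0 t with h | h
  · have := eq_flow_of_hasDerivAt (a := 0) (b := t) (t := t)
      (HasDerivAt.continuousOn fun u _ => hd u) (fun u _ => hd u) ⟨h, le_rfl⟩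
    simpa using this.symm
  · have := eq_flow_of_hasDerivAt (a := t) (b := 0) (t := 0)
      (HasDerivAt.continuousOn fun u _ => hd u) (fun u _ => hd u) ⟨h, le_rfl⟩
    have h2 := congrArg (fun w => flow (a • (1 : Matrix (Fin d) (Fin d) ℝ)) w t) this
    simp only [flow_flow] at h2
    simpa [flow_zero] using h2

/-! ### Words of a switching system -/

/-- A finite sequence of pairs (regime, length) that may follow the regime `A` in a system with
regimes from `𝒜` and switching intervals of length between `m` and `N`. -/
def IsWord (𝒜 : Set (Matrix (Fin d) (Fin d) ℝ)) (m N : Matrix (Fin d) (Fin d) ℝ → ℝ) :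
    Matrix (Fin d) (Fin d) ℝ → List (Matrix (Fin d) (Fin d) ℝ × ℝ) → Prop
  | _, [] => True
  | A, l :: w => l.1 ≠ A ∧ (l.1 ∈ 𝒜 ∧ m l.1 ≤ l.2 ∧ l.2 ≤ N l.1) ∧ IsWord 𝒜 m N l.1 w

/-- The last regime of a word that follows the regime `A`. -/
def lastRegime : Matrix (Fin d) (Fin d) ℝ → List (Matrix (Fin d) (Fin d) ℝ × ℝ) →
    Matrix (Fin d) (Fin d) ℝ
  | A, [] => A
  | _, l :: w => lastRegime l.1 w

/-- The evolution operator of a word. -/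
noncomputable def evol : List (Matrix (Fin d) (Fin d) ℝ × ℝ) → (Fin d → ℝ) →ₗ[ℝ] (Fin d → ℝ)
  | [] => LinearMap.id
  | l :: w => evol w ∘ₗ flowMap l.1 l.2

/-- The total length of the switching intervals of a word. -/
noncomputable def duration (w : List (Matrix (Fin d) (Fin d) ℝ × ℝ)) : ℝ :=
  (w.map fun l => l.2).sum

/-- The total length of the switching intervals of a word, each of them cut at length `1`. -/
noncomputable def clock (w : List (Matrix (Fin d) (Fin d) ℝ × ℝ)) : ℝ :=
  (w.map fun l => min l.2 1).sum

variable {𝒜 : Set (Matrix (Fin d) (Fin d) ℝ)} {m N : Matrix (Fin d) (Fin d) ℝ → ℝ}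
  {A : Matrix (Fin d) (Fin d) ℝ} {w w' : List (Matrix (Fin d) (Fin d) ℝ × ℝ)}

theorem isWord_append :
    IsWord 𝒜 m N A (w ++ w') ↔ IsWord 𝒜 m N A w ∧ IsWord 𝒜 m N (lastRegime A w) w' := by
  induction w generalizing A with
  | nil => simp [IsWord, lastRegime]
  | cons l w ih => simp [IsWord, lastRegime, ih, and_assoc]

theorem lastRegime_append : lastRegime A (w ++ w') = lastRegime (lastRegime A w) w' := by
  induction w generalizing A with
  | nil => rfl
  | cons l w ih => simp [lastRegime, ih]

theorem evol_append (v : Fin d → ℝ) : evol (w ++ w') v = evol w' (evol w v) := by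
  induction w generalizing v with
  | nil => rfl
  | cons l w ih => simp [evol, ih]

theorem duration_append : duration (w ++ w') = duration w + duration w' := by simp [duration]

theorem clock_append : clock (w ++ w') = clock w + clock w' := by simp [clock]

@[simp]
theorem evol_nil (v : Fin d → ℝ) : evol [] v = v := rfl

theorem evol_cons (l : Matrix (Fin d) (Fin d) ℝ × ℝ) (v : Fin d → ℝ) :
    evol (l :: w) v = evol w (flow l.1 v l.2) := rfl

@[simp]
theorem clock_nil : clock ([] : List (Matrix (Fin d) (Fin d) ℝ × ℝ)) = 0 := rfl

theorem clock_cons (l : Matrix (Fin d) (Fin d) ℝ × ℝ) :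
    clock (l :: w) = min l.2 1 + clock w := by simp [clock]

theorem clock_le_duration : clock w ≤ duration w :=
  List.sum_le_sum fun _ _ => min_le_left _ _

theorem IsWord.clock_nonneg (hm : ∀ A ∈ 𝒜, 0 < m A) (hw : IsWord 𝒜 m N A w) : 0 ≤ clock w := by
  induction w generalizing A with
  | nil => simp
  | cons l w ih =>
    rw [clock_cons]
    have h1 := ih hw.2.2
    have h2 : 0 < min l.2 1 := lt_min ((hm _ hw.2.1.1).trans_le hw.2.1.2.1) one_pos
    linarith

/-- In a stable system, every infinite sequence of switchings leads to the origin. -/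
theorem tendsto_evol_of_stable (hm : ∀ A ∈ 𝒜, 0 < m A)
    (hst : Stable 𝒜 m (fun A => ENNReal.ofReal (N A)))
    {W : ℕ → List (Matrix (Fin d) (Fin d) ℝ × ℝ)} (hW : ∀ n, IsWord 𝒜 m N A (W n))
    (hpre : ∀ n, W n <+: W (n + 1)) (hlen : ∀ n, n ≤ (W n).length)
    (hdur : ∀ r : ℝ, ∃ n, r ≤ duration (W n)) (v : Fin d → ℝ) :
    Tendsto (fun n => evol (W n) v) atTop (𝓝 0) := by
  have hpre' : ∀ i j, i ≤ j → W i <+: W j := fun i j h =>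
    Nat.le_induction (List.prefix_refl _) (fun j _ ih => ih.trans (hpre j)) j h
  let l : ℕ → Matrix (Fin d) (Fin d) ℝ × ℝ := fun i =>
    (W (i + 1))[i]'(hlen (i + 1))
  let L : ℕ → List (Matrix (Fin d) (Fin d) ℝ × ℝ) := fun k => (List.range k).map l
  have hWL : ∀ n, W n = L (W n).length := by
    intro n
    refine List.ext_getElem (by simp [L]) fun i h1 h2 => ?_
    simp only [L, List.getElem_map, List.getElem_range, l]
    rcases le_total n (i + 1) with h | h
    · exact (hpre' _ _ h).getElem h1
    · exact ((hpre' _ _ h).getElem (hlen (i + 1))).symm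
  have hLsucc : ∀ k, L (k + 1) = L k ++ [l k] := fun k => by simp [L, List.range_succ]
  have hLpre : ∀ i j, i ≤ j → L i <+: L j := fun i j h =>
    Nat.le_induction (List.prefix_refl _)
      (fun j _ ih => ih.trans (by rw [hLsucc]; exact List.prefix_append _ _)) j h
  have hLW : ∀ k, IsWord 𝒜 m N A (L k) := by
    intro k
    obtain ⟨t, ht⟩ := hLpre _ _ (hlen k)
    have := hW k
    rw [hWL k, ← ht] at this
    exact (isWord_append.1 this).1
  have hl : ∀ k, (l k).1 ∈ 𝒜 ∧ m (l k).1 ≤ (l k).2 ∧ (l k).2 ≤ N (l k).1 := by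
    intro k
    have := hLW (k + 1)
    rw [hLsucc] at this
    exact (isWord_append.1 this).2.2.1
  have hne : ∀ k, (l (k + 1)).1 ≠ (l k).1 := by
    intro k
    have := hLW (k + 1 + 1)
    rw [hLsucc, hLsucc] at this
    have h := (isWord_append.1 this).2.1
    rwa [lastRegime_append] at h
  set s : ℕ → ℝ := fun k => (l k).2
  set B : ℕ → Matrix (Fin d) (Fin d) ℝ := fun k => (l k).1
  have hs : ∀ k, 0 < s k := fun k => (hm _ (hl k).1).trans_le (hl k).2.1
  have hstart : ∀ k, startTime s k = duration (L k) := by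
    intro k
    induction k with
    | zero => simp [startTime_zero, L, duration]
    | succ k ih => rw [startTime_succ, hLsucc, duration_append, ih]; simp [duration, s]
  have hstate : ∀ k, switchState B s v k = evol (L k) v := by
    intro k
    induction k with
    | zero => simp [switchState, L]
    | succ k ih => rw [hLsucc, evol_append, ← ih]; rfl
  have hlim : Tendsto (startTime s) atTop atTop := by
    refine tendsto_atTop_atTop_of_monotone (strictMono_startTime hs).monotone fun r => ?_
    obtain ⟨n, hn⟩ := hdur r
    exact ⟨(W n).length, by rw [hstart, ← hWL]; exact hn⟩
  have hadm := lawOf_admissible hs hlim hne (fun k => (hl k).1) (fun k => (hl k).2.1)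
    (fun k => (hl k).2.2)
  obtain ⟨x, hx, hxs⟩ := exists_isTrajectory_lawOf B s hs hlim hne v
  have h1 := (hst _ hadm x hx).comp hlim
  have h2 : Tendsto (fun k => evol (L k) v) atTop (𝓝 0) := by
    refine h1.congr fun k => ?_
    rw [Function.comp_apply, hxs k _ ⟨le_rfl, (strictMono_startTime hs k.lt_succ_self).le⟩,
      sub_self, flow_zero, hstate]
  have h3 := h2.comp (tendsto_atTop_mono hlen tendsto_id)
  refine h3.congr fun n => ?_
  rw [Function.comp_apply, ← hWL]

end

/-! ### Uniform boundedness of the evolution operators -/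

section

variable {d : ℕ}

variable {𝒜 : Set (Matrix (Fin d) (Fin d) ℝ)} {m N : Matrix (Fin d) (Fin d) ℝ → ℝ}

theorem exists_prefix_chain {α : Type*} {P : ℕ → List α → Prop} (h0 : P 0 [])
    (hstep : ∀ n w, P n w → ∃ u, u ≠ [] ∧ P (n + 1) (w ++ u)) :
    ∃ W : ℕ → List α, (∀ n, P n (W n)) ∧ (∀ n, W n <+: W (n + 1)) ∧ ∀ n, n ≤ (W n).length := by
  choose! f hf using hstep
  let W : ℕ → List α := fun n => Nat.rec [] (fun n w => w ++ f n w) n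
  have hW : ∀ n, W (n + 1) = W n ++ f n (W n) := fun n => rfl
  have hP : ∀ n, P n (W n) := by
    intro n
    induction n with
    | zero => exact h0
    | succ n ih => exact (hf n _ ih).2
  refine ⟨W, hP, fun n => hW n ▸ List.prefix_append _ _, fun n => ?_⟩
  induction n with
  | zero => exact Nat.zero_le _
  | succ n ih =>
    have := List.length_pos_iff.2 (hf n _ (hP n)).1
    rw [hW, List.length_append]
    omega

theorem norm_evol_le_exp {R : ℝ} (hR : ∀ A ∈ 𝒜, ∀ v : Fin d → ℝ, ‖A *ᵥ v‖ ≤ R * ‖v‖)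
    (hm : ∀ A ∈ 𝒜, 0 < m A) {A : Matrix (Fin d) (Fin d) ℝ}
    {w : List (Matrix (Fin d) (Fin d) ℝ × ℝ)} (hw : IsWord 𝒜 m N A w) (v : Fin d → ℝ) :
    ‖evol w v‖ ≤ Real.exp (R * duration w) * ‖v‖ := by
  induction w generalizing A v with
  | nil => simp [duration]
  | cons l w ih =>
    rw [evol_cons, show duration (l :: w) = l.2 + duration w by simp [duration], mul_add,
      Real.exp_add]
    have h1 := norm_flow_le_exp (hR _ hw.2.1.1) v ((hm _ hw.2.1.1).le.trans hw.2.1.2.1)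
    refine (ih hw.2.2 _).trans ?_
    calc Real.exp (R * duration w) * ‖flow l.1 v l.2‖
        ≤ Real.exp (R * duration w) * (Real.exp (R * l.2) * ‖v‖) := by gcongr
      _ = _ := by ring

/-- The vectors that are not driven to infinity by the words following the regime `A`. -/
def boundedSubmodule (𝒜 : Set (Matrix (Fin d) (Fin d) ℝ))
    (m N : Matrix (Fin d) (Fin d) ℝ → ℝ) (A : Matrix (Fin d) (Fin d) ℝ) :
    Submodule ℝ (Fin d → ℝ) where
  carrier := {v | ∃ C, ∀ w, IsWord 𝒜 m N A w → ‖evol w v‖ ≤ C}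
  zero_mem' := ⟨0, fun w _ => by simp⟩
  add_mem' := by
    rintro v u ⟨C, hC⟩ ⟨D, hD⟩
    exact ⟨C + D, fun w hw => by
      rw [map_add]
      exact (norm_add_le _ _).trans (add_le_add (hC w hw) (hD w hw))⟩
  smul_mem' := by
    rintro c v ⟨C, hC⟩
    exact ⟨‖c‖ * C, fun w hw => by
      rw [map_smul, norm_smul]
      gcongr
      exact hC w hw⟩

theorem map_boundedSubmodule_le {A B : Matrix (Fin d) (Fin d) ℝ} (hB : B ∈ 𝒜) (hne : B ≠ A)
    {s : ℝ} (h1 : m B ≤ s) (h2 : s ≤ N B) :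
    (boundedSubmodule 𝒜 m N A).map (flowMap B s) ≤ boundedSubmodule 𝒜 m N B := by
  rintro _ ⟨v, ⟨C, hC⟩, rfl⟩
  exact ⟨C, fun w hw => hC ((B, s) :: w) ⟨hne, ⟨hB, h1, h2⟩, hw⟩⟩

/-- An admissible step is injective and carries one subspace into the other. Exchanging the regimes
gives equality of dimensions, so steps are bijective between the subspaces. -/
theorem finrank_boundedSubmodule_le (hN : ∀ A ∈ 𝒜, m A ≤ N A) {A B : Matrix (Fin d) (Fin d) ℝ}
    (hB : B ∈ 𝒜) (hne : B ≠ A) :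
    Module.finrank ℝ (boundedSubmodule 𝒜 m N A) ≤ Module.finrank ℝ (boundedSubmodule 𝒜 m N B) := by
  rw [(Submodule.equivMapOfInjective (flowMap B (m B)) (flowMap_injective B (m B))
    (boundedSubmodule 𝒜 m N A)).finrank_eq]
  exact Submodule.finrank_mono (map_boundedSubmodule_le hB hne le_rfl (hN B hB))

theorem map_boundedSubmodule (hN : ∀ A ∈ 𝒜, m A ≤ N A) {A B : Matrix (Fin d) (Fin d) ℝ}
    (hA : A ∈ 𝒜) (hB : B ∈ 𝒜) (hne : B ≠ A) {s : ℝ} (h1 : m B ≤ s) (h2 : s ≤ N B) :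
    (boundedSubmodule 𝒜 m N A).map (flowMap B s) = boundedSubmodule 𝒜 m N B := by
  refine Submodule.eq_of_le_of_finrank_le (map_boundedSubmodule_le hB hne h1 h2) ?_
  rw [← (Submodule.equivMapOfInjective (flowMap B s) (flowMap_injective B s)
    (boundedSubmodule 𝒜 m N A)).finrank_eq]
  exact finrank_boundedSubmodule_le hN hA hne.symm

/-- Contrapositively, a vector that can be driven to infinity keeps this property whatever word is
applied to it. -/
theorem IsWord.evol_mem_boundedSubmodule (hN : ∀ A ∈ 𝒜, m A ≤ N A)
    {A : Matrix (Fin d) (Fin d) ℝ} (hA : A ∈ 𝒜) {w : List (Matrix (Fin d) (Fin d) ℝ × ℝ)}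
    (hw : IsWord 𝒜 m N A w) {v : Fin d → ℝ}
    (hv : evol w v ∈ boundedSubmodule 𝒜 m N (lastRegime A w)) :
    v ∈ boundedSubmodule 𝒜 m N A := by
  induction w generalizing A v with
  | nil => exact hv
  | cons l w ih =>
    have h1 := ih hw.2.1.1 hw.2.2 hv
    rw [← map_boundedSubmodule hN hA hw.2.1.1 hw.1 hw.2.1.2.1 hw.2.1.2.2] at h1
    obtain ⟨u, hu, huv⟩ := h1
    rwa [← flowMap_injective _ _ huv]

/-- From a vector outside the subspace, words making the state larger and larger can be chained
forever, giving an unbounded trajectory. -/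
theorem boundedSubmodule_eq_top {R : ℝ} (hR0 : 0 ≤ R)
    (hR : ∀ A ∈ 𝒜, ∀ v : Fin d → ℝ, ‖A *ᵥ v‖ ≤ R * ‖v‖)
    (hm : ∀ A ∈ 𝒜, 0 < m A) (hN : ∀ A ∈ 𝒜, m A ≤ N A)
    (hst : Stable 𝒜 m (fun A => ENNReal.ofReal (N A)))
    {A : Matrix (Fin d) (Fin d) ℝ} (hA : A ∈ 𝒜) : boundedSubmodule 𝒜 m N A = ⊤ := by
  rw [Submodule.eq_top_iff']
  intro v
  by_contra hv
  obtain ⟨W, hW, hpre, hlen⟩ := exists_prefix_chain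
    (P := fun n w => IsWord 𝒜 m N A w ∧ evol w v ∉ boundedSubmodule 𝒜 m N (lastRegime A w) ∧
      (n : ℝ) ≤ ‖evol w v‖) ⟨trivial, hv, by simp⟩ (by
    rintro n w ⟨hw, hwv, hn⟩
    have h1 : ¬ ∃ C, ∀ u, IsWord 𝒜 m N (lastRegime A w) u → ‖evol u (evol w v)‖ ≤ C := hwv
    push Not at h1
    obtain ⟨u, hu, hlt⟩ := h1 (max (n + 1 : ℕ) ‖evol w v‖)
    have hwu := isWord_append.2 ⟨hw, hu⟩
    refine ⟨u, ?_, hwu, fun h => hv (hwu.evol_mem_boundedSubmodule hN hA h), ?_⟩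
    · rintro rfl
      exact absurd hlt (not_lt.2 (le_max_right _ _))
    · rw [evol_append]
      exact (le_max_left _ _).trans hlt.le)
  -- Growth is at most exponential in time, so norms tending to infinity rule out accumulation of
  -- switching points.
  have hdur : ∀ r : ℝ, ∃ n, r ≤ duration (W n) := by
    intro r
    obtain ⟨n, hn⟩ := exists_nat_gt (Real.exp (R * r) * ‖v‖)
    refine ⟨n, ?_⟩
    by_contra! h
    have h1 := norm_evol_le_exp hR hm (hW n).1 v
    have h2 : Real.exp (R * duration (W n)) * ‖v‖ ≤ Real.exp (R * r) * ‖v‖ := by gcongr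
    linarith [(hW n).2.2]
  have hlim := (tendsto_evol_of_stable hm hst (fun n => (hW n).1) hpre hlen hdur v).norm
  rw [norm_zero] at hlim
  obtain ⟨n, hn, hn1⟩ := ((hlim.eventually_lt_const one_pos).and (eventually_ge_atTop 1)).exists
  have := (hW n).2.2
  have h1 : (1 : ℝ) ≤ n := by exact_mod_cast hn1
  linarith

theorem exists_evol_bound_of_mem {R : ℝ} (hR0 : 0 ≤ R)
    (hR : ∀ A ∈ 𝒜, ∀ v : Fin d → ℝ, ‖A *ᵥ v‖ ≤ R * ‖v‖)
    (hm : ∀ A ∈ 𝒜, 0 < m A) (hN : ∀ A ∈ 𝒜, m A ≤ N A)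
    (hst : Stable 𝒜 m (fun A => ENNReal.ofReal (N A)))
    {A : Matrix (Fin d) (Fin d) ℝ} (hA : A ∈ 𝒜) :
    ∃ K : ℝ, ∀ w, IsWord 𝒜 m N A w → ∀ v, ‖evol w v‖ ≤ K * ‖v‖ := by
  obtain ⟨K, hK⟩ := banach_steinhaus
    (g := fun w : {w // IsWord 𝒜 m N A w} => LinearMap.toContinuousLinearMap (evol w.1)) (by
    intro v
    have hv : v ∈ boundedSubmodule 𝒜 m N A := by
      rw [boundedSubmodule_eq_top hR0 hR hm hN hst hA]
      trivial
    obtain ⟨C, hC⟩ := hv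
    exact ⟨C, fun w => hC w.1 w.2⟩)
  refine ⟨K, fun w hw v => ?_⟩
  exact ((LinearMap.toContinuousLinearMap (evol w)).le_opNorm v).trans
    (mul_le_mul_of_nonneg_right (hK ⟨w, hw⟩) (norm_nonneg v))

/-- The evolution operators of all words of a stable system are uniformly bounded. -/
theorem exists_evol_bound {R : ℝ} (hR0 : 0 ≤ R)
    (hR : ∀ A ∈ 𝒜, ∀ v : Fin d → ℝ, ‖A *ᵥ v‖ ≤ R * ‖v‖)
    (hm : ∀ A ∈ 𝒜, 0 < m A) (hN : ∀ A ∈ 𝒜, m A ≤ N A)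
    (hst : Stable 𝒜 m (fun A => ENNReal.ofReal (N A)))
    {A₁ A₂ : Matrix (Fin d) (Fin d) ℝ} (hA₁ : A₁ ∈ 𝒜) (hA₂ : A₂ ∈ 𝒜) (hne : A₁ ≠ A₂) :
    ∃ K : ℝ, 1 ≤ K ∧ ∀ A w, IsWord 𝒜 m N A w → ∀ v, ‖evol w v‖ ≤ K * ‖v‖ := by
  obtain ⟨K₁, h₁⟩ := exists_evol_bound_of_mem hR0 hR hm hN hst hA₁
  obtain ⟨K₂, h₂⟩ := exists_evol_bound_of_mem hR0 hR hm hN hst hA₂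
  refine ⟨max 1 (max K₁ K₂), le_max_left _ _, fun A w hw v => ?_⟩
  -- The first letter differs from `A₁` or from `A₂`, so two constants cover all preceding regimes.
  have hor : IsWord 𝒜 m N A₁ w ∨ IsWord 𝒜 m N A₂ w := by
    cases w with
    | nil => exact Or.inl trivial
    | cons l w =>
      by_cases h : l.1 = A₁
      · exact Or.inr ⟨h ▸ hne, hw.2⟩
      · exact Or.inl ⟨h, hw.2⟩
  rcases hor with h | h
  · refine (h₁ w h v).trans ?_
    gcongr
    exact (le_max_left _ _).trans (le_max_right _ _)
  · refine (h₂ w h v).trans ?_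
    gcongr
    exact (le_max_right _ _).trans (le_max_right _ _)

end

/-! ### Exponential contraction of words -/

section

variable {d : ℕ}

variable {𝒜 : Set (Matrix (Fin d) (Fin d) ℝ)} {m N : Matrix (Fin d) (Fin d) ℝ → ℝ}

theorem exists_append_clock {w : List (Matrix (Fin d) (Fin d) ℝ × ℝ)} {r : ℝ} (h0 : 0 ≤ r)
    (hr : r ≤ clock w) : ∃ w₁ w₂, w = w₁ ++ w₂ ∧ r ≤ clock w₁ ∧ clock w₁ ≤ r + 1 := by
  induction w generalizing r with
  | nil => exact ⟨[], [], rfl, hr, by rw [clock_nil]; linarith⟩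
  | cons l w ih =>
    rcases le_or_gt r (min l.2 1) with h | h
    · refine ⟨[l], w, rfl, ?_, ?_⟩ <;> rw [clock_cons, clock_nil, add_zero]
      · exact h
      · exact (min_le_right _ _).trans (by linarith)
    · rw [clock_cons] at hr
      obtain ⟨w₁, w₂, rfl, h1, h2⟩ := ih (r := r - min l.2 1) (by linarith) (by linarith)
      exact ⟨l :: w₁, w₂, rfl, by rw [clock_cons]; linarith, by rw [clock_cons]; linarith⟩

/-- A nonempty word that may follow itself. -/
def IsRepeatable (𝒜 : Set (Matrix (Fin d) (Fin d) ℝ)) (m N : Matrix (Fin d) (Fin d) ℝ → ℝ)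
    (u : List (Matrix (Fin d) (Fin d) ℝ × ℝ)) : Prop :=
  u ≠ [] ∧ ∀ A, IsWord 𝒜 m N (lastRegime A u) u

/-- If neither piece is repeatable, `u₁` begins and ends with one regime and `u₂` with another;
these differ since `u₂` follows `u₁`, so the concatenation is repeatable. -/
theorem isRepeatable_or {u₁ u₂ : List (Matrix (Fin d) (Fin d) ℝ × ℝ)} (h₁ : u₁ ≠ [])
    (h₂ : u₂ ≠ []) {A : Matrix (Fin d) (Fin d) ℝ} (hw : IsWord 𝒜 m N A (u₁ ++ u₂)) :
    IsRepeatable 𝒜 m N u₁ ∨ IsRepeatable 𝒜 m N u₂ ∨ IsRepeatable 𝒜 m N (u₁ ++ u₂) := by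
  obtain ⟨l₁, v₁, rfl⟩ := List.exists_cons_of_ne_nil h₁
  obtain ⟨l₂, v₂, rfl⟩ := List.exists_cons_of_ne_nil h₂
  obtain ⟨hw₁, hw₂⟩ := isWord_append.1 hw
  by_cases e₁ : l₁.1 = lastRegime l₁.1 v₁
  · by_cases e₂ : l₂.1 = lastRegime l₂.1 v₂
    · refine Or.inr (Or.inr ⟨by simp, fun B => ⟨?_, hw.2⟩⟩)
      rw [lastRegime_append]
      change l₁.1 ≠ lastRegime l₂.1 v₂
      rw [← e₂, e₁]
      exact hw₂.1.symm
    · exact Or.inr (Or.inl ⟨by simp, fun B => ⟨e₂, hw₂.2⟩⟩)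
  · exact Or.inl ⟨by simp, fun B => ⟨e₁, hw₁.2⟩⟩

/-- If long words are not contracting, there are repeatable words that almost fix some vector of
bounded norm. -/
theorem exists_almost_fixed {K : ℝ} (hK1 : 1 ≤ K)
    (hK : ∀ A w, IsWord 𝒜 m N A w → ∀ v, ‖evol w v‖ ≤ K * ‖v‖) (hm : ∀ A ∈ 𝒜, 0 < m A)
    (hcon : ∀ Θ > (0 : ℝ), ∃ A w, IsWord 𝒜 m N A w ∧ Θ ≤ clock w ∧
      ∃ v, 1 / 2 * ‖v‖ < ‖evol w v‖) {η : ℝ} (hη : 0 < η) :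
    ∃ y : Fin d → ℝ, 1 / (2 * K) ≤ ‖y‖ ∧ ‖y‖ ≤ K ∧ ∃ u, IsRepeatable 𝒜 m N u ∧ 1 ≤ clock u ∧
      ‖evol u y - y‖ ≤ η := by
  obtain ⟨t, -, ht, hcov⟩ := Metric.finite_approx_of_totallyBounded
    (isCompact_closedBall (0 : Fin d → ℝ) K).totallyBounded (η / 2) (half_pos hη)
  lift t to Finset (Fin d → ℝ) using ht
  set n := t.card
  -- A clock of at least `4n` allows cuts near the readings `2j` for `j = 0, …, 2n`. Each cut
  -- overshoots by at most `1`, so successive ones are at least `1` apart.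
  obtain ⟨A, w, hw, hclock, v₀, hv₀⟩ := hcon (4 * n + 1) (by positivity)
  have hv₀pos : 0 < ‖v₀‖ := by
    rw [norm_pos_iff]
    rintro rfl
    simp at hv₀
  set v := ‖v₀‖⁻¹ • v₀
  have hv1 : ‖v‖ = 1 := by
    rw [norm_smul, norm_inv, norm_norm, inv_mul_cancel₀ hv₀pos.ne']
  have hvw : 1 / 2 < ‖evol w v‖ := by
    rw [map_smul, norm_smul, norm_inv, norm_norm, ← div_eq_inv_mul, lt_div_iff₀ hv₀pos]
    exact hv₀
  have hcut : ∀ j : ℕ, j ∈ Finset.range (2 * n + 1) →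
      ∃ w₁ w₂, w = w₁ ++ w₂ ∧ (2 * j : ℝ) ≤ clock w₁ ∧ clock w₁ ≤ 2 * j + 1 := by
    intro j hj
    refine exists_append_clock (by positivity) (le_trans ?_ hclock)
    have : (j : ℝ) ≤ 2 * n := by
      exact_mod_cast Nat.lt_succ_iff.1 (Finset.mem_range.1 hj)
    linarith
  choose! p q hpq hlo hhi using hcut
  have hp : ∀ j ∈ Finset.range (2 * n + 1), IsWord 𝒜 m N A (p j) ∧
      IsWord 𝒜 m N (lastRegime A (p j)) (q j) := fun j hj => by
    rw [hpq j hj] at hw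
    exact isWord_append.1 hw
  have hup : ∀ j ∈ Finset.range (2 * n + 1), ‖evol (p j) v‖ ≤ K := fun j hj => by
    simpa [hv1] using hK _ _ (hp j hj).1 v
  have hlow : ∀ j ∈ Finset.range (2 * n + 1), 1 / (2 * K) ≤ ‖evol (p j) v‖ := fun j hj => by
    have h1 := hK _ _ (hp j hj).2 (evol (p j) v)
    rw [← evol_append, ← hpq j hj] at h1
    rw [div_le_iff₀ (by positivity)]
    linarith
  have hcenter : ∀ j ∈ Finset.range (2 * n + 1), ∃ c ∈ t, dist (evol (p j) v) c < η / 2 := by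
    intro j hj
    have := hcov (mem_closedBall_zero_iff.2 (hup j hj))
    simpa using this
  choose! c hct hcd using hcenter
  -- Pigeonhole: `2n + 1` states and `n` balls put three states in one ball. Three are needed
  -- because only two consecutive pieces guarantee a repeatable word.
  obtain ⟨y, -, hy⟩ := Finset.exists_lt_card_fiber_of_mul_lt_card_of_maps_to (n := 2) hct
    (by rw [Finset.card_range]; change n * 2 < 2 * n + 1; omega)
  set F := (Finset.range (2 * n + 1)).filter fun j => c j = y
  obtain ⟨F', hF', hcard⟩ := Finset.exists_subset_card_eq (Nat.succ_le_of_lt hy)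
  let e := F'.orderEmbOfFin hcard
  have heF : ∀ i, e i ∈ Finset.range (2 * n + 1) ∧ c (e i) = y := fun i =>
    Finset.mem_filter.1 (hF' (F'.orderEmbOfFin_mem hcard i))
  have hclose : ∀ i j, ‖evol (p (e i)) v - evol (p (e j)) v‖ ≤ η := fun i j => by
    have h1 := hcd _ (heF i).1
    have h2 := hcd _ (heF j).1
    rw [(heF i).2] at h1
    rw [(heF j).2] at h2
    rw [← dist_eq_norm]
    have := dist_triangle_right (evol (p (e i)) v) (evol (p (e j)) v) y
    linarith
  have hext : ∀ i j, i < j → ∃ u, p (e j) = p (e i) ++ u ∧ 1 ≤ clock u := by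
    intro i j hij
    have hlt : e i < e j := e.strictMono hij
    have hlt' : ((e i : ℕ) : ℝ) + 1 ≤ (e j : ℕ) := by exact_mod_cast hlt
    have h1 := hhi _ (heF i).1
    have h2 := hlo _ (heF j).1
    have hpi : p (e i) <+: w := by
      rw [hpq _ (heF i).1]
      exact List.prefix_append _ _
    have hpj : p (e j) <+: w := by
      rw [hpq _ (heF j).1]
      exact List.prefix_append _ _
    rcases List.prefix_or_prefix_of_prefix hpi hpj with ⟨u, hu⟩ | ⟨u, hu⟩
    · refine ⟨u, hu.symm, ?_⟩
      rw [← hu, clock_append] at h2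
      linarith
    · have h3 := (hp _ (heF i).1).1
      rw [← hu] at h3
      have h4 := (isWord_append.1 h3).2.clock_nonneg hm
      rw [← hu, clock_append] at h1
      linarith
  obtain ⟨u₁, hu₁, hc₁⟩ := hext 0 1 (by decide)
  obtain ⟨u₂, hu₂, hc₂⟩ := hext 1 2 (by decide)
  have hne : ∀ u : List (Matrix (Fin d) (Fin d) ℝ × ℝ), 1 ≤ clock u → u ≠ [] := by
    rintro u h rfl
    rw [clock_nil] at h
    linarith
  have hword := (hp _ (heF 2).1).1
  rw [hu₂, hu₁, List.append_assoc] at hword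
  rcases isRepeatable_or (hne _ hc₁) (hne _ hc₂) (isWord_append.1 hword).2 with h | h | h
  · refine ⟨_, hlow _ (heF 0).1, hup _ (heF 0).1, u₁, h, hc₁, ?_⟩
    rw [← evol_append, ← hu₁]
    exact hclose 1 0
  · refine ⟨_, hlow _ (heF 1).1, hup _ (heF 1).1, u₂, h, hc₂, ?_⟩
    rw [← evol_append, ← hu₂]
    exact hclose 2 1
  · refine ⟨_, hlow _ (heF 0).1, hup _ (heF 0).1, u₁ ++ u₂, h, ?_, ?_⟩
    · rw [clock_append]
      linarith
    · rw [← evol_append, ← List.append_assoc, ← hu₁, ← hu₂]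
      exact hclose 2 0

/-- The almost fixed vectors lie in a compact annulus; a limit point works for every `η` because the
evolution operators are uniformly bounded. -/
theorem exists_almost_fixed_vector {K : ℝ} (hK1 : 1 ≤ K)
    (hK : ∀ A w, IsWord 𝒜 m N A w → ∀ v, ‖evol w v‖ ≤ K * ‖v‖) (hm : ∀ A ∈ 𝒜, 0 < m A)
    (hcon : ∀ Θ > (0 : ℝ), ∃ A w, IsWord 𝒜 m N A w ∧ Θ ≤ clock w ∧
      ∃ v, 1 / 2 * ‖v‖ < ‖evol w v‖) :
    ∃ y : Fin d → ℝ, y ≠ 0 ∧ ∀ η > (0 : ℝ), ∃ u, IsRepeatable 𝒜 m N u ∧ 1 ≤ clock u ∧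
      ‖evol u y - y‖ ≤ η := by
  have h := fun n : ℕ =>
    exists_almost_fixed hK1 hK hm hcon (Nat.one_div_pos_of_nat (α := ℝ) (n := n))
  choose z hz1 hz2 u hu hcu hzu using h
  obtain ⟨y, -, φ, hφ, hlim⟩ := (isCompact_closedBall (0 : Fin d → ℝ) K).tendsto_subseq
    (fun n => mem_closedBall_zero_iff.2 (hz2 n))
  have hynorm : 1 / (2 * K) ≤ ‖y‖ := ge_of_tendsto' hlim.norm fun n => hz1 _
  refine ⟨y, norm_pos_iff.1 (lt_of_lt_of_le (by positivity) hynorm), fun η hη => ?_⟩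
  have h1 : ∀ᶠ n in atTop, ‖z (φ n) - y‖ < η / (2 * (K + 1)) := by
    have := (hlim.sub_const y).norm
    rw [sub_self, norm_zero] at this
    exact this.eventually_lt_const (by positivity)
  have h2 : ∀ᶠ n in atTop, 1 / ((φ n : ℝ) + 1) < η / 2 :=
    (tendsto_one_div_add_atTop_nhds_zero_nat.comp hφ.tendsto_atTop).eventually_lt_const
      (half_pos hη)
  obtain ⟨n, hn1, hn2⟩ := (h1.and h2).exists
  refine ⟨u (φ n), hu _, hcu _, ?_⟩
  have e : evol (u (φ n)) y - y = (evol (u (φ n)) (z (φ n)) - z (φ n)) +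
      ((z (φ n) - y) - evol (u (φ n)) (z (φ n) - y)) := by
    rw [map_sub]
    abel
  have h3 := hK _ _ ((hu (φ n)).2 0) (z (φ n) - y)
  have h4 := hzu (φ n)
  rw [lt_div_iff₀ (by positivity)] at hn1
  rw [e]
  refine (norm_add_le _ _).trans ?_
  have := norm_sub_le (z (φ n) - y) (evol (u (φ n)) (z (φ n) - y))
  linarith

/-- In a stable system, all sufficiently long words are contracting. -/
theorem exists_clock_contraction {K : ℝ} (hK1 : 1 ≤ K)
    (hK : ∀ A w, IsWord 𝒜 m N A w → ∀ v, ‖evol w v‖ ≤ K * ‖v‖) (hm : ∀ A ∈ 𝒜, 0 < m A)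
    (hst : Stable 𝒜 m (fun A => ENNReal.ofReal (N A))) :
    ∃ Θ > (0 : ℝ), ∀ A w, IsWord 𝒜 m N A w → Θ ≤ clock w → ∀ v, ‖evol w v‖ ≤ 1 / 2 * ‖v‖ := by
  by_contra! hcon
  obtain ⟨y, hy, hfix⟩ := exists_almost_fixed_vector hK1 hK hm hcon
  have hy0 : 0 < ‖y‖ := norm_pos_iff.2 hy
  -- A set of regimes after which almost fixing words can always be continued within the set.
  obtain ⟨Z, b₀, hb₀, hZ⟩ : ∃ (Z : Set (Matrix (Fin d) (Fin d) ℝ)) (b₀ : _), b₀ ∈ Z ∧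
      ∀ b ∈ Z, ∀ η > (0 : ℝ), ∃ u, u ≠ [] ∧ IsWord 𝒜 m N b u ∧ lastRegime b u ∈ Z ∧ 1 ≤ clock u ∧
        ‖evol u y - y‖ ≤ η := by
    -- If one regime `a` starts arbitrarily good almost fixing words, these words end with a regime
    -- other than `a` and so can follow each other.
    by_cases ha : ∃ a, ∀ η > (0 : ℝ), ∃ l u, IsRepeatable 𝒜 m N (l :: u) ∧ l.1 = a ∧
        1 ≤ clock (l :: u) ∧ ‖evol (l :: u) y - y‖ ≤ η
    · obtain ⟨a, ha⟩ := ha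
      have hlast : ∀ l u, IsRepeatable 𝒜 m N (l :: u) → l.1 = a →
          ∀ b, lastRegime b (l :: u) ≠ a := fun l u h hl b => hl ▸ (h.2 b).1.symm
      obtain ⟨l, u, hu, hl, -⟩ := ha 1 one_pos
      refine ⟨{b | b ≠ a}, _, hlast l u hu hl 0, fun b hb η hη => ?_⟩
      obtain ⟨l, u, hu, hl, hc, hn⟩ := ha η hη
      exact ⟨l :: u, hu.1, ⟨hl ▸ Ne.symm hb, (hu.2 b).2⟩, hlast l u hu hl b, hc, hn⟩
    -- Otherwise each regime `b` starts only words with error above some threshold, so a word with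
    -- smaller error may follow `b`.
    · push Not at ha
      refine ⟨Set.univ, 0, trivial, fun b _ η hη => ?_⟩
      obtain ⟨η', hη', hb⟩ := ha b
      obtain ⟨u, hu, hc, hn⟩ := hfix (min η η') (lt_min hη hη')
      obtain ⟨l, v, rfl⟩ := List.exists_cons_of_ne_nil hu.1
      refine ⟨_, hu.1, ⟨fun h => ?_, (hu.2 b).2⟩, trivial, hc, hn.trans (min_le_left _ _)⟩
      exact absurd (hn.trans (min_le_right _ _)) (not_le.2 (hb l v hu h hc))
  -- Errors are summable, with total at most `‖y‖ / 2`, and the bound is kept under every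
  -- continuation. The resulting trajectory returns forever to within `‖y‖ / 2` of `y`, against
  -- stability.
  obtain ⟨W, hW, hpre, hlen⟩ := exists_prefix_chain
    (P := fun n w => IsWord 𝒜 m N b₀ w ∧ lastRegime b₀ w ∈ Z ∧ (n : ℝ) ≤ clock w ∧
      ∀ w', IsWord 𝒜 m N (lastRegime b₀ w) w' →
        ‖evol w' (evol w y - y)‖ ≤ ‖y‖ / 2 * (1 - (1 / 2) ^ n))
    ⟨trivial, hb₀, by simp, fun w' _ => by simp⟩ (by
    rintro n w ⟨hw, hwZ, hn, hdev⟩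
    obtain ⟨u, hune, hu, huZ, hc, hnorm⟩ := hZ _ hwZ (‖y‖ / 2 * (1 / 2) ^ (n + 1) / K)
      (by positivity)
    refine ⟨u, hune, isWord_append.2 ⟨hw, hu⟩, ?_, ?_, fun w' hw' => ?_⟩
    · rwa [lastRegime_append]
    · rw [clock_append]
      push_cast
      linarith
    · rw [lastRegime_append] at hw'
      have h1 := hdev (u ++ w') (isWord_append.2 ⟨hu, hw'⟩)
      have h2 := hK _ _ hw' (evol u y - y)
      have e : evol w' (evol (w ++ u) y - y) =
          evol (u ++ w') (evol w y - y) + evol w' (evol u y - y) := by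
        simp only [evol_append, map_sub]
        abel
      have h3 : K * ‖evol u y - y‖ ≤ ‖y‖ / 2 * (1 / 2) ^ (n + 1) := by
        rw [mul_comm]
        exact (le_div_iff₀ (by positivity)).1 hnorm
      rw [e]
      refine (norm_add_le _ _).trans ?_
      have h4 : ((1 : ℝ) / 2) ^ (n + 1) = (1 / 2) ^ n / 2 := by rw [pow_succ]; ring
      rw [h4] at h3 ⊢
      linarith)
  have hdur : ∀ r : ℝ, ∃ n, r ≤ duration (W n) := fun r => by
    obtain ⟨n, hn⟩ := exists_nat_ge r
    exact ⟨n, hn.trans ((hW n).2.2.1.trans clock_le_duration)⟩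
  have hlim := ((tendsto_evol_of_stable hm hst (fun n => (hW n).1) hpre hlen hdur y).sub_const
    y).norm
  have h1 : ‖(0 : Fin d → ℝ) - y‖ ≤ ‖y‖ / 2 := by
    refine le_of_tendsto' hlim fun n => ((hW n).2.2.2 [] trivial).trans ?_
    have : (0 : ℝ) ≤ (1 / 2) ^ n := by positivity
    nlinarith
  rw [zero_sub, norm_neg] at h1
  linarith

/-- In a stable system, the words are exponentially contracting. -/
theorem exists_exp_clock_bound {K : ℝ} (hK1 : 1 ≤ K)
    (hK : ∀ A w, IsWord 𝒜 m N A w → ∀ v, ‖evol w v‖ ≤ K * ‖v‖) (hm : ∀ A ∈ 𝒜, 0 < m A)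
    (hst : Stable 𝒜 m (fun A => ENNReal.ofReal (N A))) :
    ∃ α > (0 : ℝ), ∀ A w, IsWord 𝒜 m N A w → ∀ v,
      Real.exp (α * clock w) * ‖evol w v‖ ≤ 2 * K * ‖v‖ := by
  obtain ⟨Θ, hΘ, hcontr⟩ := exists_clock_contraction hK1 hK hm hst
  -- Blocks have clock between `Θ` and `Θ + 1` and each halves the norm, which `α` balances exactly
  -- on the longest block.
  have hα : Real.log 2 / (Θ + 1) * (Θ + 1) = Real.log 2 := div_mul_cancel₀ _ (by positivity)
  have hα0 : 0 < Real.log 2 / (Θ + 1) := div_pos (Real.log_pos one_lt_two) (by positivity)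
  set α := Real.log 2 / (Θ + 1)
  have hexp : ∀ r, r ≤ Θ + 1 → Real.exp (α * r) ≤ 2 := fun r hr => by
    rw [← Real.exp_log (zero_lt_two' ℝ), Real.exp_le_exp, ← hα]
    gcongr
  refine ⟨α, hα0, fun A w => ?_⟩
  induction hn : w.length using Nat.strong_induction_on generalizing A w with
  | _ n ih =>
    intro hw v
    rcases lt_or_ge (clock w) Θ with h | h
    · have h1 := hexp (clock w) (by linarith)
      calc Real.exp (α * clock w) * ‖evol w v‖ ≤ 2 * (K * ‖v‖) := by
            gcongr
            exact hK A w hw v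
        _ = _ := by ring
    · obtain ⟨w₁, w₂, rfl, h1, h2⟩ := exists_append_clock hΘ.le h
      obtain ⟨hw₁, hw₂⟩ := isWord_append.1 hw
      have hne : w₁ ≠ [] := by
        rintro rfl
        rw [clock_nil] at h1
        linarith
      have hlen := List.length_pos_iff.2 hne
      have h3 := ih _ (by rw [← hn, List.length_append]; omega) _ w₂ rfl hw₂ (evol w₁ v)
      have h4 := hcontr A w₁ hw₁ h1 v
      have h5 := hexp _ h2
      rw [evol_append, clock_append, mul_add, Real.exp_add, mul_assoc]
      calc Real.exp (α * clock w₁) * (Real.exp (α * clock w₂) * ‖evol w₂ (evol w₁ v)‖)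
          ≤ 2 * (2 * K * (1 / 2 * ‖v‖)) := by
            refine mul_le_mul h5 (h3.trans ?_) (by positivity) zero_le_two
            gcongr
        _ = _ := by ring

end

/-! ### Decay over switching intervals of arbitrary length -/

section

variable {d : ℕ}

variable {𝒜 : Set (Matrix (Fin d) (Fin d) ℝ)} {m N : Matrix (Fin d) (Fin d) ℝ → ℝ}

/-- After the regime `A`, all words acting on `v` decay with rate `α`, with the constant `c`. -/
def DecaysFrom (𝒜 : Set (Matrix (Fin d) (Fin d) ℝ)) (m N : Matrix (Fin d) (Fin d) ℝ → ℝ) (α : ℝ)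
    (A : Matrix (Fin d) (Fin d) ℝ) (v : Fin d → ℝ) (c : ℝ) : Prop :=
  ∀ w, IsWord 𝒜 m N A w → Real.exp (α * clock w) * ‖evol w v‖ ≤ c

theorem DecaysFrom.norm_le {α : ℝ} {A : Matrix (Fin d) (Fin d) ℝ} {v : Fin d → ℝ} {c : ℝ}
    (h : DecaysFrom 𝒜 m N α A v c) : ‖v‖ ≤ c := by
  simpa using h [] trivial

theorem DecaysFrom.step {α : ℝ} {A B : Matrix (Fin d) (Fin d) ℝ} {v : Fin d → ℝ} {c : ℝ}
    (h : DecaysFrom 𝒜 m N α A v c) (hne : B ≠ A) (hB : B ∈ 𝒜) {s : ℝ} (h1 : m B ≤ s)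
    (h2 : s ≤ N B) : DecaysFrom 𝒜 m N α B (flow B v s) (Real.exp (-(α * min s 1)) * c) := by
  intro w hw
  have := h ((B, s) :: w) ⟨hne, ⟨hB, h1, h2⟩, hw⟩
  rw [clock_cons, evol_cons, mul_add, Real.exp_add, mul_assoc] at this
  rwa [Real.exp_neg, ← div_eq_inv_mul, le_div_iff₀' (Real.exp_pos _)]

/-- Switching intervals of arbitrary length decrease the constant of decay, uniformly. -/
theorem exists_decay_step (hm : ∀ A ∈ 𝒜, 0 < m A) (hH : ∀ A ∈ 𝒜, IsHurwitz A)
    {R C lam α K : ℝ} (hR0 : 0 < R) (hR : ∀ A ∈ 𝒜, ∀ v : Fin d → ℝ, ‖A *ᵥ v‖ ≤ R * ‖v‖)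
    (hC0 : 0 ≤ C) (hC : ∀ A ∈ 𝒜, ∀ (v : Fin d → ℝ) (t : ℝ), 0 ≤ t → ‖flow A v t‖ ≤ C * ‖v‖)
    (hlam0 : 0 < lam) (hlam : ∀ a : ℝ, a • 1 ∈ 𝒜 → a ≤ -lam) (hα : 0 < α) (hK0 : 0 ≤ K)
    (hK : ∀ A w, IsWord 𝒜 m (fun A => m A + Tcut A) A w → ∀ v,
      Real.exp (α * clock w) * ‖evol w v‖ ≤ K * ‖v‖) :
    ∃ γ > (0 : ℝ), ∀ (A B : Matrix (Fin d) (Fin d) ℝ) (v : Fin d → ℝ) (c t : ℝ), B ∈ 𝒜 → B ≠ A →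
      m B ≤ t → DecaysFrom 𝒜 m (fun A => m A + Tcut A) α A v c →
      DecaysFrom 𝒜 m (fun A => m A + Tcut A) α B (flow B v t)
        (Real.exp (-(γ * min t 1)) * c) := by
  obtain ⟨δ, hδ0, hδ1, hδ⟩ := exists_le_Tcut (d := d) hR0
  have hexp1 : ∀ y : ℝ, 0 < y → Real.exp (-y) < 1 := fun y hy =>
    Real.exp_lt_one_iff.2 (neg_lt_zero.2 hy)
  set ρ := Real.exp (-(α * δ))
  have hρ1 : ρ < 1 := hexp1 _ (by positivity)
  have hρ0 : 0 < ρ := Real.exp_pos _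
  have hQ : 0 < 2 * (K * (R * C * C)) + 1 := by positivity
  -- The time `r` is short enough that running past `m B + Tcut B` by at most `r` costs at most half
  -- of the gain `1 - ρ`.
  set r := min δ ((1 - ρ) / (2 * (K * (R * C * C)) + 1))
  have hr0 : 0 < r := lt_min hδ0 (div_pos (by linarith) hQ)
  have hrδ : r ≤ δ := min_le_left _ _
  have hrQ : K * (R * C * C) * r ≤ (1 - ρ) / 2 := by
    have := (le_div_iff₀ hQ).1 (min_le_right δ ((1 - ρ) / (2 * (K * (R * C * C)) + 1)))
    change r * _ ≤ _ at this
    nlinarith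
  set g := max (Real.exp (-(α * r))) ((1 + ρ) / 2)
  have hg1 : g < 1 := max_lt (hexp1 _ (by positivity)) (by linarith)
  have hg0 : 0 < g := lt_max_of_lt_left (Real.exp_pos _)
  have hlog : 0 < -Real.log g := neg_pos.2 (Real.log_neg hg0 hg1)
  set γ := min (min α lam) (-Real.log g)
  have hγ0 : 0 < γ := lt_min (lt_min hα hlam0) hlog
  have hγα : γ ≤ α := (min_le_left _ _).trans (min_le_left _ _)
  have hγlam : γ ≤ lam := (min_le_left _ _).trans (min_le_right _ _)
  have hγg : g ≤ Real.exp (-γ) := by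
    rw [← Real.log_le_iff_le_exp hg0]
    linarith [min_le_right (min α lam) (-Real.log g)]
  refine ⟨γ, hγ0, fun A B v c t hB hne ht hdec => ?_⟩
  have hmB := hm B hB
  have hc := hdec.norm_le
  have hc0 : 0 ≤ c := (norm_nonneg v).trans hc
  have hT0 := Tcut_nonneg B
  have hmin0 : ∀ s : ℝ, 0 < s → 0 ≤ min s 1 := fun s hs => (lt_min hs one_pos).le
  -- A short interval is itself an admissible letter and decreases the constant with rate `α`.
  rcases le_or_gt t (m B + Tcut B) with hle | hgt
  · intro w hw
    refine (hdec.step hne hB ht hle w hw).trans ?_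
    have := hmin0 t (hmB.trans_le ht)
    gcongr
  rcases hδ B (hH B hB) (hR B hB) with ⟨a, rfl⟩ | hδT
  -- For a scalar regime the excess over `m` merely multiplies the state by an exponential of rate
  -- at most `-lam`.
  · intro w hw
    have h1 := hdec.step hne hB le_rfl (by simpa using hT0) w hw
    set μ := m (a • 1)
    have e : flow (a • 1) v t = Real.exp (a * (t - μ)) • flow (a • 1) v μ := by
      rw [← flow_smul_one, flow_flow, add_sub_cancel]
    rw [e, map_smul, norm_smul, Real.norm_of_nonneg (Real.exp_pos _).le, mul_left_comm]
    refine (mul_le_mul_of_nonneg_left h1 (Real.exp_pos _).le).trans ?_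
    rw [← mul_assoc, ← Real.exp_add]
    gcongr
    have h2 : a * (t - μ) ≤ -γ * (t - μ) :=
      mul_le_mul_of_nonneg_right ((hlam a hB).trans (by linarith)) (by linarith)
    have h3 : γ * min μ 1 ≤ α * min μ 1 :=
      mul_le_mul_of_nonneg_right hγα (hmin0 μ hmB)
    have h4 : min t 1 ≤ (t - μ) + min μ 1 := by
      rcases min_cases μ 1 with h | h <;> rw [h.1]
      · linarith [min_le_left t 1]
      · linarith [min_le_right t 1]
    have h5 := mul_le_mul_of_nonneg_left h4 hγ0.le
    linarith
  · intro w hw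
    set T := Tcut B
    suffices hmain : Real.exp (α * clock w) * ‖evol w (flow B v t)‖ ≤ g * c by
      refine hmain.trans ?_
      gcongr
      refine hγg.trans (Real.exp_le_exp.2 (neg_le_neg ?_))
      exact mul_le_of_le_one_right hγ0.le (min_le_right _ _)
    -- Starting from `m B` could give `s = 0` and no uniform gain when `m B` is tiny; starting at `m
    -- B + r` guarantees a competing length of at least `r`.
    obtain ⟨s, hs, hmax⟩ := exists_seminorm_flow_le (hH B hB)
      ((normSeminorm ℝ (Fin d → ℝ)).comp (evol w)) (flow B v (m B + r)) hT0 le_rfl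
    have h1 := hmax (t - (m B + r)) (by linarith)
    rw [flow_flow, flow_flow, add_sub_cancel] at h1
    have h1' : ‖evol w (flow B v t)‖ ≤ ‖evol w (flow B v (m B + r + s))‖ := h1
    refine (mul_le_mul_of_nonneg_left h1' (Real.exp_pos _).le).trans ?_
    rcases le_or_gt (r + s) T with hrs | hrs
    · refine (hdec.step hne hB (s := m B + r + s) (by linarith [hs.1])
        (by linarith) w hw).trans ?_
      gcongr
      refine le_trans (Real.exp_le_exp.2 (neg_le_neg ?_)) (le_max_left _ _)
      gcongr
      exact le_min (by linarith [hs.1]) (by linarith)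
    -- The competing time overshoots the longest admissible length by `q ≤ r`, so the state is a
    -- small perturbation of the admissible state `z`.
    · set z := flow B v (m B + T)
      set q := r + s - T
      have hq0 : 0 ≤ q := by simp only [q]; linarith
      have hqr : q ≤ r := by simp only [q]; linarith [hs.2]
      have e1 : flow B v (m B + r + s) = z + (flow B z q - z) := by
        rw [add_sub_cancel, flow_flow]
        congr 1
        simp only [q]
        ring
      have h2 : ‖flow B z q - z‖ ≤ R * C * C * r * c := by
        refine (norm_flow_sub_le hR0.le (hR B hB) z (τ := q)
          (fun u hu => hC B hB z u hu.1) ⟨hq0, le_rfl⟩).trans ?_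
        have h3 : ‖z‖ ≤ C * c := (hC B hB v _ (by linarith)).trans (by gcongr)
        calc R * C * ‖z‖ * q ≤ R * C * (C * c) * r := by gcongr
          _ = _ := by ring
      have h4 := hdec.step hne hB (s := m B + T) (by linarith) le_rfl w hw
      have h5 : Real.exp (-(α * min (m B + T) 1)) ≤ ρ := by
        refine Real.exp_le_exp.2 (neg_le_neg ?_)
        gcongr
        exact le_min (by linarith) hδ1
      have h6 : Real.exp (α * clock w) * ‖evol w (flow B z q - z)‖ ≤ (1 - ρ) / 2 * c := by
        refine (hK B w hw _).trans ((mul_le_mul_of_nonneg_left h2 hK0).trans ?_)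
        have := mul_le_mul_of_nonneg_right hrQ hc0
        linarith
      rw [e1, map_add]
      calc Real.exp (α * clock w) * ‖evol w z + evol w (flow B z q - z)‖
          ≤ Real.exp (α * clock w) * (‖evol w z‖ + ‖evol w (flow B z q - z)‖) := by
            gcongr
            exact norm_add_le _ _
        _ ≤ ρ * c + (1 - ρ) / 2 * c := by
            rw [mul_add]
            exact add_le_add (h4.trans (by gcongr)) h6
        _ = (1 + ρ) / 2 * c := by ring
        _ ≤ g * c := by
            gcongr
            exact le_max_right _ _

/-- If the truncated series converged, its terms would tend to `0`, so truncation would change only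
finitely many of them. -/
theorem tendsto_sum_min_one {t : ℕ → ℝ} (ht : ∀ k, 0 ≤ t k)
    (hlim : Tendsto (fun n => ∑ i ∈ Finset.range n, t i) atTop atTop) :
    Tendsto (fun n => ∑ i ∈ Finset.range n, min (t i) 1) atTop atTop := by
  rw [← not_summable_iff_tendsto_nat_atTop_of_nonneg ht] at hlim
  rw [← not_summable_iff_tendsto_nat_atTop_of_nonneg fun k => le_min (ht k) zero_le_one]
  intro hsum
  refine hlim ((summable_congr_cofinite ?_).1 hsum)
  filter_upwards [hsum.tendsto_cofinite_zero.eventually_lt_const one_pos] with k hk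
  rw [min_eq_left]
  by_contra! h
  rw [min_eq_right h.le] at hk
  exact lt_irrefl _ hk

theorem exists_scalar_rate {T₀ : ℝ} (hT₀ : 0 < T₀) (hd : 0 < d)
    (hT : ∀ A ∈ 𝒜, ∃ T ∈ Set.Ioc 0 T₀, ∀ v, ‖flow A v T‖ ≤ 1 / 2 * ‖v‖) {a : ℝ}
    (ha : a • 1 ∈ 𝒜) : a ≤ -(Real.log 2 / T₀) := by
  obtain ⟨T, hT, h⟩ := hT _ ha
  have : Nonempty (Fin d) := ⟨⟨0, hd⟩⟩
  have h1 := h (fun _ => 1)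
  rw [flow_smul_one, norm_smul, Real.norm_of_nonneg (Real.exp_pos _).le, pi_norm_const,
    norm_one, mul_one, mul_one, ← Real.le_log_iff_exp_le (by norm_num), one_div,
    Real.log_inv] at h1
  have h2 := Real.log_pos one_lt_two
  rw [← neg_div, le_div_iff₀ hT₀]
  have ha0 : a < 0 := by
    by_contra! h3
    have := mul_nonneg h3 hT.1.le
    linarith
  have := mul_le_mul_of_nonpos_left hT.2 ha0.le
  linarith

theorem Law.tendsto_toReal_time {σ : Law d} (hσ : ∀ k, σ.time k ≠ ⊤) :
    Tendsto (fun k => (σ.time k).toReal) atTop atTop := by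
  refine tendsto_atTop.2 fun r => ?_
  filter_upwards [σ.time_tendsto.eventually (lt_mem_nhds (ENNReal.ofReal_lt_top (r := r)))]
    with k hk
  exact (ENNReal.ofReal_le_iff_le_toReal (hσ k)).1 hk.le

theorem Law.IsTrajectory.tendsto_of_time_eq_top {σ : Law d} {x : ℝ → Fin d → ℝ}
    (hx : σ.IsTrajectory x) {M : Matrix (Fin d) (Fin d) ℝ → ℝ≥0∞} (hσ : σ.Admissible 𝒜 m M)
    (hH : ∀ A ∈ 𝒜, IsHurwitz A) (hex : ∃ k, σ.time k = ⊤) : Tendsto x atTop (𝓝 0) := by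
  classical
  obtain ⟨j, hj⟩ : ∃ j, Nat.find hex = j + 1 := Nat.exists_eq_succ_of_ne_zero fun h => by
    have := Nat.find_spec hex
    rw [h, σ.time_zero] at this
    exact ENNReal.zero_ne_top this
  have htop : σ.time (j + 1) = ⊤ := hj ▸ Nat.find_spec hex
  have hne : σ.time j ≠ ⊤ := Nat.find_min hex (by omega)
  have h1 := (tendsto_flow_of_isHurwitz (hH _ (hσ j hne).1) (x (σ.time j).toReal)).comp
    (tendsto_atTop_add_const_right atTop (-(σ.time j).toReal) tendsto_id)
  refine h1.congr' ?_
  filter_upwards [eventually_ge_atTop (σ.time j).toReal] with t ht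
  rw [hx.eq_flow hne ht (by rw [htop]; exact le_top), sub_eq_add_neg]
  rfl

theorem Law.IsTrajectory.tendsto_of_tendsto_time {σ : Law d} {x : ℝ → Fin d → ℝ}
    (hx : σ.IsTrajectory x) (hfin : ∀ k, σ.time k ≠ ⊤) {C : ℝ}
    (hC : ∀ k (v : Fin d → ℝ) (t : ℝ), 0 ≤ t → ‖flow (σ.regime k) v t‖ ≤ C * ‖v‖)
    (hlim : Tendsto (fun k => x (σ.time k).toReal) atTop (𝓝 0)) : Tendsto x atTop (𝓝 0) := by
  classical
  have hτ := Law.tendsto_toReal_time hfin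
  have hmono : Monotone fun k => (σ.time k).toReal :=
    fun _ j h => ENNReal.toReal_mono (hfin j) (σ.time_mono h)
  have h1 := hlim.norm.const_mul C
  rw [norm_zero, mul_zero] at h1
  refine Metric.tendsto_atTop.2 fun ε hε => ?_
  obtain ⟨n, hn⟩ := eventually_atTop.1 (h1.eventually_lt_const hε)
  refine ⟨(σ.time n).toReal, fun t ht => ?_⟩
  have hex : ∃ k, t < (σ.time (k + 1)).toReal :=
    (((tendsto_add_atTop_iff_nat 1).2 hτ).eventually_gt_atTop t).exists
  obtain ⟨k, hk, hmin⟩ : ∃ k, t < (σ.time (k + 1)).toReal ∧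
      ∀ j < k, ¬ t < (σ.time (j + 1)).toReal :=
    ⟨Nat.find hex, Nat.find_spec hex, fun j => Nat.find_min hex⟩
  have hnk : n ≤ k := by
    by_contra! h
    exact absurd (hk.trans_le ((hmono (Nat.succ_le_of_lt h)).trans ht)) (lt_irrefl t)
  have hkt : (σ.time k).toReal ≤ t := by
    cases k with
    | zero => simpa [σ.time_zero] using ENNReal.toReal_nonneg.trans ht
    | succ k => exact not_lt.1 (hmin k k.lt_succ_self)
  rw [dist_zero_right, hx.eq_flow (hfin k) hkt
    ((ENNReal.ofReal_le_iff_le_toReal (hfin _)).2 hk.le)]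
  exact (hC k _ _ (sub_nonneg.2 hkt)).trans_lt (hn k hnk)

/-- If a system with switching intervals bounded by `m + Tcut` is stable and its regimes are
Hurwitz, then the system without upper bounds on the switching intervals is stable. -/
theorem stable_of_stable_cut_tail (h𝒜 : IsCompact 𝒜) (hm : ∀ A ∈ 𝒜, 0 < m A)
    (hH : ∀ A ∈ 𝒜, IsHurwitz A)
    (hst : Stable 𝒜 m (fun A => ENNReal.ofReal (m A + Tcut A))) :
    Stable 𝒜 m (fun _ => ⊤) := by
  intro σ hσ x hx
  by_cases hex : ∃ k, σ.time k = ⊤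
  · exact hx.tendsto_of_time_eq_top hσ hH hex
  push Not at hex
  -- In dimension zero a scalar matrix does not determine its factor, so the rate bound for scalar
  -- regimes needs `0 < d`.
  rcases Nat.eq_zero_or_pos d with rfl | hd
  · rw [Subsingleton.elim x 0]
    exact tendsto_const_nhds
  obtain ⟨R, hR0, hR⟩ := exists_mulVec_bound h𝒜
  obtain ⟨T₀, hT₀, hT⟩ := exists_uniform_contraction h𝒜 hH
  have hC : ∀ A ∈ 𝒜, ∀ (v : Fin d → ℝ) (t : ℝ), 0 ≤ t →
      ‖flow A v t‖ ≤ Real.exp (R * T₀) * ‖v‖ := fun A hA v t ht => by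
    obtain ⟨T, hT, h⟩ := hT A hA
    exact norm_flow_le_of_contraction hR0.le (hR A hA) hT h v ht
  have hmem : ∀ k, σ.regime k ∈ 𝒜 := fun k => (hσ k (hex k)).1
  obtain ⟨K, hK1, hK⟩ := exists_evol_bound (N := fun A => m A + Tcut A) hR0.le hR hm
    (fun A _ => by simpa using Tcut_nonneg A) hst (hmem 1) (hmem 0) (σ.regime_ne 0 (hex 1))
  obtain ⟨α, hα, hdecay⟩ := exists_exp_clock_bound hK1 hK hm hst
  obtain ⟨γ, hγ, hstep⟩ := exists_decay_step hm hH hR0 hR (Real.exp_pos _).le hC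
    (div_pos (Real.log_pos one_lt_two) hT₀) (fun a ha => exists_scalar_rate hT₀ hd hT ha) hα
    (by positivity) hdecay
  set τ : ℕ → ℝ := fun k => (σ.time k).toReal
  -- The first switching interval is skipped: a word must follow a regime, so decay is tracked from
  -- `τ 1` on.
  set t : ℕ → ℝ := fun k => τ (k + 2) - τ (k + 1)
  have hτmono : ∀ k, τ k ≤ τ (k + 1) := fun k =>
    ENNReal.toReal_mono (hex _) (σ.time_mono k.le_succ)
  have ht0 : ∀ k, 0 ≤ t k := fun k => sub_nonneg.2 (hτmono _)
  have hτlim : Tendsto τ atTop atTop := Law.tendsto_toReal_time hex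
  have hmt : ∀ k, m (σ.regime (k + 1)) ≤ t k := fun k => by
    have h1 := (hσ (k + 1) (hex _)).2.1
    change _ ≤ (σ.time (k + 1 + 1)).toReal - (σ.time (k + 1)).toReal
    rw [← ENNReal.toReal_sub_of_le (σ.time_mono (k + 1).le_succ) (hex _)]
    refine (ENNReal.ofReal_le_iff_le_toReal ?_).1 h1
    exact ENNReal.sub_ne_top (hex _)
  set S : ℕ → ℝ := fun n => ∑ i ∈ Finset.range n, min (t i) 1
  have hS : Tendsto S atTop atTop := by
    refine tendsto_sum_min_one ht0 ?_
    have : ∀ n, ∑ i ∈ Finset.range n, t i = τ (n + 1) - τ 1 := fun n =>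
      Finset.sum_range_sub (fun k => τ (k + 1)) n
    simp_rw [this]
    exact tendsto_atTop_add_const_right _ _ ((tendsto_add_atTop_iff_nat 1).2 hτlim)
  have hdec : ∀ k, DecaysFrom 𝒜 m (fun A => m A + Tcut A) α (σ.regime k) (x (τ (k + 1)))
      (Real.exp (-(γ * S k)) * (2 * K * ‖x (τ 1)‖)) := by
    intro k
    induction k with
    | zero =>
      intro w hw
      simpa [S] using hdecay _ w hw (x (τ 1))
    | succ k ih =>
      have h1 := hstep _ _ _ _ _ (hmem (k + 1)) (σ.regime_ne k (hex _)) (hmt k) ih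
      rw [← hx.eq_flow_succ (hex (k + 2)), ← mul_assoc, ← Real.exp_add] at h1
      convert! h1 using 3
      simp only [S, Finset.sum_range_succ]
      ring
  refine hx.tendsto_of_tendsto_time hex (fun k => hC _ (hmem k)) ?_
  rw [← tendsto_add_atTop_iff_nat 1]
  refine squeeze_zero_norm (fun k => (hdec k).norm_le) ?_
  have h1 := (Real.tendsto_exp_neg_atTop_nhds_zero.comp (hS.const_mul_atTop hγ)).mul_const
    (2 * K * ‖x (τ 1)‖)
  rwa [zero_mul] at h1

end

end SwitchingSystem

theorem theorem3p1 {d : ℕ} (𝒜 : Set (Matrix (Fin d) (Fin d) ℝ)) (h𝒜 : IsCompact 𝒜)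
    (m : Matrix (Fin d) (Fin d) ℝ → ℝ) (hm : ∀ A ∈ 𝒜, 0 < m A) :
    (SwitchingSystem.Stable 𝒜 m (fun _ => ⊤) ↔
      (∀ A ∈ 𝒜, SwitchingSystem.IsHurwitz A) ∧
        SwitchingSystem.Stable 𝒜 m
          (fun A => ENNReal.ofReal (m A + SwitchingSystem.Tcut A))) ∧
    ((∀ A ∈ 𝒜, SwitchingSystem.IsHurwitz A) →
      ∀ f : Matrix (Fin d) (Fin d) ℝ → Seminorm ℝ (Fin d → ℝ),
        SwitchingSystem.IsLyapunovMultinorm 𝒜 m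
            (fun A => ENNReal.ofReal (m A + SwitchingSystem.Tcut A)) f →
          SwitchingSystem.IsLyapunovMultinorm 𝒜 m (fun _ => ⊤) f) :=
  ⟨⟨fun h => ⟨fun _ hA => SwitchingSystem.isHurwitz_of_stable h hA, h.mono fun _ => le_top⟩,
    fun h => SwitchingSystem.stable_of_stable_cut_tail h𝒜 hm h.1 h.2⟩,
    fun hH _ hf => hf.of_cut_tail hm hH⟩
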